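/- **Setting.** Let $(\Omega,\mathcal F,P)$ be a probability space, $N\ge 1$, $(\mathcal F_n)_{0\le n\le N}$ a filtration, and $(X_n)_{0\le n\le N}$ a real adapted process with $X_0=0$ and independent (possibly non-stationary) increments relative to $(\mathcal F_n)$: for $n=1,\dots,N$ the increment $\Delta X_n=X_n-X_{n-1}$ is independent of $\mathcal F_{n-1}$. (If $(\mathcal F_n)$ is the filtration generated by $X$, this just says that $\Delta X_1,\dots,\Delta X_N$ are independent.) Let $S_n=s_0\exp(X_n)$ with $s_0>0$ and $\Delta S_n=S_n-S_{n-1}$. Put $D=\{z\in\mathbb C:\ \exp(zX_N)\in L^1\}$ and $m(z,n)=\mathbb E[e^{z\Delta X_n}]$. Assume that $2\in D$ and that no $\Delta X_n$ ($1\le n\le N$) is almost surely constant. Let $\Pi$ be a finite complex Borel measure on $\mathbb C$ and let $I_0=\{\mathrm{Re}\,z:\ z\in\mathrm{supp}\,\Pi\}$. Assume that $I_0$ is compact and $2I_0\subset D$. Let $f$ be a real-valued function with $f(s)=\int_{\mathbb C}s^z\,\Pi(dz)$ for $s>0$, and let $H=f(S_N)$. Let $\Theta$ be the set of processes $\varphi=(\varphi_n)_{1\le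 n\le N}$ with $\varphi_n$ real-valued and $\mathcal F_{n-1}$-measurable and $\varphi_n\Delta S_n\in L^2$ for all $n$, and let $G_n(\varphi)=\sum_{i=1}^n\varphi_i\Delta S_i$. The variance-optimal hedging problem is to minimize $\mathbb E[(H-V_0-G_N(\varphi))^2]$ over $V_0\in\mathbb R$ and $\varphi\in\Theta$. A real discrete Föllmer–Schweizer decomposition of a square integrable $H$ consists of $H_0\in\mathbb R$, $\xi^H\in\Theta$ and a real square integrable martingale $L^H$ with $\mathbb E[L^H_0]=0$ such that $H=H_0+G_N(\xi^H)+L^H_N$ a.s. and $L^HM$ is a martingale, where $M$ is the martingale part of the Doob decomposition of $S$; we then write $H_n=H_0+G_n(\xi^H)+L^H_n$ (so $H_N=H$ a.s.; the constant $H_0$ agrees a.s. with the value of the process at time $0$). **Theorem.** 1. $H$ is square integrable and has a real discrete Föllmer–Schweizer decomposition for which, with $$g(z,n)=\frac{m(z+1,n)-m(1,n)m(z,n)}{m(2,n)-m(1,n)^2},\qquad h(z,n)=\prod_{i=n+1}^N\bigl(m(z,i)-g(z,i)[m(1,i)-1]\bigr),$$ one has $H_0=\int_{\mathbb C} h(z,0)s_0^z\,\Pi(dz)$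 and, almost surely, $$H_n=\int_{\mathbb C}h(z,n)S_n^z\,\Pi(dz)\quad(0\le n\le N),\qquad \xi^H_n=\int_{\mathbb C}g(z,n)h(z,n)S_{n-1}^{z-1}\,\Pi(dz)\quad(1\le n\le N).$$ 2. For every real discrete Föllmer–Schweizer decomposition of $H$ (in particular the one in 1), the process $\varphi^*$ determined by $$\varphi^*_n=\xi^H_n+\lambda_n\Bigl(H_{n-1}-H_0-\sum_{i=1}^{n-1}\varphi^*_i\Delta S_i\Bigr),\qquad \lambda_n=\frac{1}{S_{n-1}}\,\frac{m(1,n)-1}{m(2,n)-2m(1,n)+1}\qquad(1\le n\le N)$$ (where $H_0$ in the bracket is the constant of the decomposition) belongs to $\Theta$, and $(V_0^*,\varphi^*)$ with $V_0^*=H_0$ solves the variance-optimal hedging problem. 3. The solution is unique up to null sets: if $(V_0,\varphi)\in\mathbb R\times\Theta$ is also a minimizer, then $V_0=V_0^*$ and $\varphi_n=\varphi^*_n$ almost surely for $n=1,\dots,N$. -/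

import Mathlib

open MeasureTheory ProbabilityTheory

namespace DiscreteHedging

noncomputable section

variable {Ω : Type*}

/-- The increment `ΔY_n = Y_n - Y_{n-1}`, for `n ≥ 1` (`ΔY_0 = 0`). -/
def incr (Y : ℕ → Ω → ℝ) (n : ℕ) : Ω → ℝ := fun ω => Y n ω - Y (n - 1) ω

/-- The gains process `G_n(φ) = ∑_{k=1}^n φ_k ΔS_k`. -/
def gains (S φ : ℕ → Ω → ℝ) (n : ℕ) (ω : Ω) : ℝ :=
  ∑ k ∈ Finset.Icc 1 n, φ k ω * incr S k ω

/-- The set `Θ` of predictable `φ` with `φ_k ΔS_k ∈ L²` for `k = 1, …, N`. -/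
structure IsAdmissible {mΩ : MeasurableSpace Ω} (P : Measure Ω) (F : Filtration ℕ mΩ) (N : ℕ)
    (S φ : ℕ → Ω → ℝ) : Prop where
  predictable : ∀ n, 1 ≤ n → n ≤ N → Measurable[F (n - 1)] (φ n)
  square_integrable : ∀ n, 1 ≤ n → n ≤ N → MemLp (fun ω => φ n ω * incr S n ω) 2 P

/-- `E[(H - V₀ - G_N(φ))²]`. -/
def hedgingError {mΩ : MeasurableSpace Ω} (P : Measure Ω) (N : ℕ) (S : ℕ → Ω → ℝ) (H : Ω → ℝ)
    (V₀ : ℝ) (φ : ℕ → Ω → ℝ) : ℝ :=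
  ∫ ω, (H ω - V₀ - gains S φ N ω) ^ 2 ∂P

/-- `(V₀, φ)` minimizes the hedging error over `ℝ × Θ`. -/
structure IsOptimal {mΩ : MeasurableSpace Ω} (P : Measure Ω) (F : Filtration ℕ mΩ) (N : ℕ)
    (S : ℕ → Ω → ℝ) (H : Ω → ℝ) (V₀ : ℝ) (φ : ℕ → Ω → ℝ) : Prop where
  admissible : IsAdmissible P F N S φ
  minimal : ∀ (V : ℝ) (ψ : ℕ → Ω → ℝ), IsAdmissible P F N S ψ →
    hedgingError P N S H V₀ φ ≤ hedgingError P N S H V ψ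

/-- `(Y_n)_{n = 0, …, N}` is a martingale (values at times `n > N` are irrelevant). -/
structure IsMartingaleUpTo {mΩ : MeasurableSpace Ω} (P : Measure Ω) (F : Filtration ℕ mΩ) (N : ℕ)
    (Y : ℕ → Ω → ℝ) : Prop where
  adapted : ∀ n ≤ N, StronglyMeasurable[F n] (Y n)
  integrable : ∀ n ≤ N, Integrable (Y n) P
  condExp_eq : ∀ k n, k ≤ n → n ≤ N → P[Y n | F k] =ᵐ[P] Y k

/-- `H = H₀ + ∑_{k=1}^N ξ_k ΔS_k + L_N` is a real discrete Föllmer-Schweizer decomposition of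
the square integrable `H`. Here `martingalePart S F P` is the martingale `M` of the Doob
decomposition `S = M + A`, `A_0 = 0`. -/
structure IsRealFSDecomposition {mΩ : MeasurableSpace Ω} (P : Measure Ω) (F : Filtration ℕ mΩ)
    (N : ℕ) (S : ℕ → Ω → ℝ) (H : Ω → ℝ) (H₀ : ℝ) (ξ L : ℕ → Ω → ℝ) : Prop where
  memLp_claim : MemLp H 2 P
  admissible : IsAdmissible P F N S ξ
  martingale : IsMartingaleUpTo P F N L
  square_integrable : ∀ n ≤ N, MemLp (L n) 2 P
  orthogonal : IsMartingaleUpTo P F N (fun n ω => L n ω * martingalePart S F P n ω)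
  expectation_zero : ∫ ω, L 0 ω ∂P = 0
  decomposition : ∀ᵐ ω ∂P, H ω = H₀ + gains S ξ N ω + L N ω

/-- The process `H_n = H₀ + ∑_{k=1}^n ξ_k ΔS_k + L_n` of a decomposition. -/
def fsValue (S : ℕ → Ω → ℝ) (H₀ : ℝ) (ξ L : ℕ → Ω → ℝ) (n : ℕ) (ω : Ω) : ℝ :=
  H₀ + gains S ξ n ω + L n ω

/-- `X_0 = 0`, `X` is adapted to `F` and has independent increments relative to `F`: each `ΔX_n` is
independent of `F_{n-1}`. In particular `ΔX_1, …, ΔX_N` are mutually independent; if `F` is the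
filtration generated by `X`, this is all that is required. -/
structure HasIndepIncrementsUpTo {mΩ : MeasurableSpace Ω} (P : Measure Ω) (F : Filtration ℕ mΩ)
    (N : ℕ) (X : ℕ → Ω → ℝ) : Prop where
  zero : ∀ ω, X 0 ω = 0
  adapted : ∀ n ≤ N, Measurable[F n] (X n)
  indep : ∀ n, 1 ≤ n → n ≤ N →
    Indep (MeasurableSpace.comap (incr X n) inferInstance) (F (n - 1)) P

/-- `S_n = s₀ exp(X_n)`. -/
def price (s₀ : ℝ) (X : ℕ → Ω → ℝ) : ℕ → Ω → ℝ := fun n ω => s₀ * Real.exp (X n ω)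

/-- `D = {z ∈ ℂ | exp(z X_N) ∈ L¹}`. -/
def expDomain {mΩ : MeasurableSpace Ω} (P : Measure Ω) (N : ℕ) (X : ℕ → Ω → ℝ) : Set ℂ :=
  {z | Integrable (fun ω => Complex.exp (z * (X N ω : ℂ))) P}

/-- `m(z, n) = E[exp(z ΔX_n)]`. -/
def m {mΩ : MeasurableSpace Ω} (P : Measure Ω) (X : ℕ → Ω → ℝ) (z : ℂ) (n : ℕ) : ℂ :=
  complexMGF (incr X n) P z

/-- `g(z, n) = (m(z+1, n) - m(1, n) m(z, n)) / (m(2, n) - m(1, n)²)`. -/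
def g {mΩ : MeasurableSpace Ω} (P : Measure Ω) (X : ℕ → Ω → ℝ) (z : ℂ) (n : ℕ) : ℂ :=
  (m P X (z + 1) n - m P X 1 n * m P X z n) / (m P X 2 n - m P X 1 n ^ 2)

/-- `h(z, n) = ∏_{i=n+1}^N (m(z, i) - g(z, i) (m(1, i) - 1))`. -/
def h {mΩ : MeasurableSpace Ω} (P : Measure Ω) (N : ℕ) (X : ℕ → Ω → ℝ) (z : ℂ) (n : ℕ) : ℂ :=
  ∏ i ∈ Finset.Icc (n + 1) N, (m P X z i - g P X z i * (m P X 1 i - 1))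

/-- The (Bochner) integral `∫ F(z) μ(dz)` of a complex function against a complex measure. -/
def cintegral (μ : ComplexMeasure ℂ) (F : ℂ → ℂ) : ℂ :=
  VectorMeasure.integral μ F (ContinuousLinearMap.mul ℝ ℂ)

/-- `∫ H(z)_n Π(dz)` with `H(z)_n = h(z, n) S_n^z`. -/
def claimProcess {mΩ : MeasurableSpace Ω} (P : Measure Ω) (N : ℕ) (s₀ : ℝ) (X : ℕ → Ω → ℝ)
    (μ : ComplexMeasure ℂ) (n : ℕ) (ω : Ω) : ℂ :=
  cintegral μ fun z => h P N X z n * (price s₀ X n ω : ℂ) ^ z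

/-- `∫ ξ(z)_n Π(dz)` with `ξ(z)_n = g(z, n) h(z, n) S_{n-1}^{z-1}`, for `n ≥ 1`. -/
def xiProcess {mΩ : MeasurableSpace Ω} (P : Measure Ω) (N : ℕ) (s₀ : ℝ) (X : ℕ → Ω → ℝ)
    (μ : ComplexMeasure ℂ) (n : ℕ) (ω : Ω) : ℂ :=
  cintegral μ fun z => g P X z n * h P N X z n * (price s₀ X (n - 1) ω : ℂ) ^ (z - 1)

/-- `λ_n = (1 / S_{n-1}) (m(1, n) - 1) / (m(2, n) - 2 m(1, n) + 1)`; the values `m(1, n)` and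
`m(2, n)` are real. -/
def lam {mΩ : MeasurableSpace Ω} (P : Measure Ω) (s₀ : ℝ) (X : ℕ → Ω → ℝ) (n : ℕ) (ω : Ω) : ℝ :=
  1 / price s₀ X (n - 1) ω *
    (((m P X 1 n).re - 1) / ((m P X 2 n).re - 2 * (m P X 1 n).re + 1))

/-- The real parts of the points in the support of (the total variation of) `μ`. -/
def reSupport (μ : ComplexMeasure ℂ) : Set ℝ := Complex.re '' μ.variation.support

end

end DiscreteHedging

/-! Write `S_n = S_{n-1} (1 + r_n)`, where the return `r_n = exp(ΔX_n) - 1` is independent of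
`F_{n-1}`. Every conditional problem then becomes a one-period regression with deterministic
coefficients.

Existence. For the payoff `s^z`, `g(z, n)` is the regression coefficient of `exp(z ΔX_n)` on `r_n`,
and `h` accumulates what is left of the mean. Superposing over `z` gives, in the log price `x`, a
value function `V_n` and a hedge amount `W_n` with `V_{n-1}(x) = E[V_n(x + ΔX_n)] - W_n(x) E[r_n]`
and `E[V_n(x + ΔX_n) (r_n - E[r_n])] = W_n(x) Var(r_n)` (`valueFun_pred`,
`integral_valueFun_mul_ret`). So `V_n(x + ΔX_n) - V_{n-1}(x) - W_n(x) r_n` is centred and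
uncorrelated with `r_n`. Freezing `x` at the past log price (`condExp_eq_zero_of_indep`) makes these
the increments of a martingale orthogonal to `M`. The same two equations carry realness backwards
from the payoff. Fubini is available because integrals against `Π` have a bounded density with
respect to the variation, and `exp(z x)` is dominated on the strip `a ≤ Re z ≤ b` by `exp(a x) +
exp(b x)`, which has second moments along `X`.

Optimality. The residual `R_n = H_n - H_0 - G_n(φ*)` satisfies `R_n = R_{n-1} (1 - (E[r_n] /
E[r_n²]) r_n) + ΔL_n`. The bracket is orthogonal to `r_n`, so `R_n` is orthogonal to each `q r_n`
with `q` square integrable and `F_{n-1}`-measurable (`IsResidual.integral_mul_ret`), and later steps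
preserve orthogonality to anything already known (`IsResidual.integral_mul_step`). Thus `R_N` is
orthogonal to constants and to all gains, and Pythagoras gives optimality. Equality in Pythagoras
makes an affine combination of returns vanish; since `Var(r_n) > 0`, it can be peeled off from the
last period (`IsRegularMarket.eq_zero_of_affine`), which gives uniqueness. -/

namespace DiscreteHedging

set_option linter.unusedSectionVars false

/-! ### Complex measures: finite variation and bounded densities -/

section ComplexMeasureDensity

variable {α : Type*} [MeasurableSpace α]

lemma variation_re_le (μ : ComplexMeasure α) : (ComplexMeasure.re μ).variation ≤ μ.variation := by
  refine VectorMeasure.variation_le_of_forall_enorm_le fun E _ => ?_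
  refine le_trans ?_ (VectorMeasure.enorm_measure_le_variation μ E)
  change ‖(μ E).re‖ₑ ≤ _
  rw [enorm_le_iff_norm_le]
  exact Complex.abs_re_le_norm _

lemma variation_im_le (μ : ComplexMeasure α) : (ComplexMeasure.im μ).variation ≤ μ.variation := by
  refine VectorMeasure.variation_le_of_forall_enorm_le fun E _ => ?_
  refine le_trans ?_ (VectorMeasure.enorm_measure_le_variation μ E)
  change ‖(μ E).im‖ₑ ≤ _
  rw [enorm_le_iff_norm_le]
  exact Complex.abs_im_le_norm _

lemma complexMeasure_apply_eq (μ : ComplexMeasure α) (s : Set α) :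
    μ s = ((ComplexMeasure.re μ s : ℝ) : ℂ) + (ComplexMeasure.im μ s : ℝ) * Complex.I :=
  (Complex.re_add_im (μ s)).symm

/-- The Jordan total variations of the real and imaginary parts are finite, and their sum dominates.
-/
lemma isFiniteMeasure_variation (μ : ComplexMeasure α) : IsFiniteMeasure μ.variation := by
  have key : μ.variation ≤
      (ComplexMeasure.re μ).totalVariation + (ComplexMeasure.im μ).totalVariation := by
    refine VectorMeasure.variation_le_of_forall_enorm_le fun E _ => ?_
    rw [complexMeasure_apply_eq, Measure.add_apply]
    refine (enorm_add_le _ _).trans (add_le_add ?_ ?_)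
    · refine le_trans (le_of_eq ?_) (SignedMeasure.enorm_le_totalVariation _ _)
      simp [← ofReal_norm]
    · refine le_trans (le_of_eq ?_) (SignedMeasure.enorm_le_totalVariation _ _)
      simp [← ofReal_norm]
  exact isFiniteMeasure_of_le _ key

/-- Radon–Nikodym: domination gives absolute continuity, and `|σ s| ≤ ρ s` on every set pins the
density between `-1` and `1`. -/
lemma exists_density_signedMeasure (σ : SignedMeasure α) (ρ : Measure α) [IsFiniteMeasure ρ]
    (hσ : σ.variation ≤ ρ) :
    ∃ θ : α → ℝ, Measurable θ ∧ (∀ᵐ x ∂ρ, |θ x| ≤ 1) ∧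
      ∀ s, MeasurableSet s → σ s = ∫ x in s, θ x ∂ρ := by
  have hac : σ ≪ᵥ ρ.toENNRealVectorMeasure := by
    refine VectorMeasure.AbsolutelyContinuous.mk fun s hs h0 => ?_
    rw [Measure.toENNRealVectorMeasure_apply_measurable hs] at h0
    have := (VectorMeasure.enorm_measure_le_variation σ s).trans (hσ s)
    rw [h0] at this
    simpa using this
  have hd := SignedMeasure.withDensityᵥ_rnDeriv_eq σ ρ hac
  have hint := SignedMeasure.integrable_rnDeriv σ ρ
  have happ : ∀ s, MeasurableSet s → σ s = ∫ x in s, σ.rnDeriv ρ x ∂ρ := fun s hs => by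
    rw [← withDensityᵥ_apply hint hs, hd]
  have hle : ∀ s, |σ s| ≤ ρ.real s := fun s => by
    rw [← Real.norm_eq_abs, measureReal_def, ← toReal_enorm]
    exact ENNReal.toReal_mono (measure_ne_top _ _)
      ((VectorMeasure.enorm_measure_le_variation σ s).trans (hσ s))
  refine ⟨σ.rnDeriv ρ, SignedMeasure.measurable_rnDeriv _ _, ?_, happ⟩
  have h1 : σ.rnDeriv ρ ≤ᵐ[ρ] fun _ => (1 : ℝ) := by
    refine ae_le_of_forall_setIntegral_le hint (integrable_const _) fun s hs _ => ?_
    rw [← happ s hs]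
    simpa using (abs_le.1 (hle s)).2
  have h2 : (fun _ => (-1 : ℝ)) ≤ᵐ[ρ] σ.rnDeriv ρ := by
    refine ae_le_of_forall_setIntegral_le (integrable_const _) hint fun s hs _ => ?_
    rw [← happ s hs]
    simpa using (abs_le.1 (hle s)).1
  filter_upwards [h1, h2] with x hx1 hx2 using abs_le.2 ⟨hx2, hx1⟩

/-- A complex measure has a bounded density with respect to its variation. -/
lemma exists_density_complexMeasure (μ : ComplexMeasure α) :
    ∃ θ : α → ℂ, Measurable θ ∧ (∀ᵐ x ∂μ.variation, ‖θ x‖ ≤ 2) ∧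
      ∀ s, MeasurableSet s → μ s = ∫ x in s, θ x ∂μ.variation := by
  have := isFiniteMeasure_variation μ
  obtain ⟨a, ham, hab, ha⟩ := exists_density_signedMeasure _ _ (variation_re_le μ)
  obtain ⟨b, hbm, hbb, hb⟩ := exists_density_signedMeasure _ _ (variation_im_le μ)
  have hai : Integrable a μ.variation :=
    Integrable.of_bound ham.aestronglyMeasurable 1 hab
  have hbi : Integrable b μ.variation :=
    Integrable.of_bound hbm.aestronglyMeasurable 1 hbb
  refine ⟨fun x => a x + b x * Complex.I, by fun_prop, ?_, fun s hs => ?_⟩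
  -- The bound `2` is crude, one unit for each of the two real densities; any finite bound would
  -- serve.
  · filter_upwards [hab, hbb] with x hx hx'
    refine (norm_add_le _ _).trans ?_
    simp only [Complex.norm_real, norm_mul, Complex.norm_I, mul_one, Real.norm_eq_abs]
    linarith
  · rw [complexMeasure_apply_eq, ha s hs, hb s hs,
      integral_add hai.ofReal.restrict (hbi.ofReal.mul_const _).restrict,
      integral_mul_const, integral_complex_ofReal, integral_complex_ofReal]

lemma integrable_mul_density {ρ : Measure α} {θ : α → ℂ} (hθ : Measurable θ)
    (hb : ∀ᵐ x ∂ρ, ‖θ x‖ ≤ 2) {F : α → ℂ} (hF : Integrable F ρ) :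
    Integrable (fun x => F x * θ x) ρ :=
  hF.mul_bdd (c := 2) hθ.aestronglyMeasurable hb

/-- Both sides are additive and continuous on `L¹` and agree on indicators, which suffices by
density. -/
lemma integral_eq_integral_density (μ : ComplexMeasure α) {θ : α → ℂ} (hθ : Measurable θ)
    (hb : ∀ᵐ x ∂μ.variation, ‖θ x‖ ≤ 2)
    (hμ : ∀ s, MeasurableSet s → μ s = ∫ x in s, θ x ∂μ.variation) {F : α → ℂ}
    (hF : Integrable F μ.variation) :
    VectorMeasure.integral μ F (ContinuousLinearMap.mul ℝ ℂ) = ∫ x, F x * θ x ∂μ.variation := by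
  have := isFiniteMeasure_variation μ
  refine Integrable.induction (P := fun F => VectorMeasure.integral μ F
    (ContinuousLinearMap.mul ℝ ℂ) = ∫ x, F x * θ x ∂μ.variation) ?_ ?_ ?_ ?_ hF
  · intro c s hs hfin
    rw [VectorMeasure.integral_eq_setToFun, setToFun_indicator_const _ hs hfin.ne]
    have : ∀ x, s.indicator (fun _ => c) x * θ x = s.indicator (fun x => c * θ x) x := fun x => by
      by_cases hx : x ∈ s <;> simp [hx]
    simp_rw [this]
    rw [integral_indicator hs, integral_const_mul, ← hμ s hs]
    rfl
  · intro f g _ hf hg ihf ihg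
    rw [VectorMeasure.integral_add hf hg, ihf, ihg,
      ← integral_add (integrable_mul_density hθ hb hf) (integrable_mul_density hθ hb hg)]
    simp [add_mul]
  · refine isClosed_eq (VectorMeasure.continuous_integral) ?_
    refine LipschitzWith.continuous (K := 2) (LipschitzWith.of_dist_le_mul fun f g => ?_)
    have hf := L1.integrable_coeFn f
    have hg := L1.integrable_coeFn g
    rw [dist_eq_norm, dist_eq_norm, L1.norm_eq_integral_norm, ← integral_sub
      (integrable_mul_density hθ hb hf) (integrable_mul_density hθ hb hg)]
    refine (norm_integral_le_integral_norm _).trans ?_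
    rw [NNReal.coe_ofNat, ← integral_const_mul]
    refine integral_mono_ae ((integrable_mul_density hθ hb hf).sub
      (integrable_mul_density hθ hb hg)).norm ((L1.integrable_coeFn (f - g)).norm.const_mul _) ?_
    filter_upwards [hb, Lp.coeFn_sub f g] with x hx hfg
    rw [hfg, Pi.sub_apply, ← sub_mul, norm_mul, mul_comm]
    exact mul_le_mul_of_nonneg_right hx (norm_nonneg _)
  · intro f g hfg hf ihf
    rw [← VectorMeasure.integral_congr_ae hfg, ihf]
    refine integral_congr_ae ?_
    filter_upwards [hfg] with x hx
    rw [hx]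

end ComplexMeasureDensity

/-! ### Products of independent factors and freezing of a known variable -/

section Independence

variable {Ω : Type*} {𝓖 mΩ : MeasurableSpace Ω} {P : Measure Ω}

lemma indepFun_of_indep_comap {β γ : Type*} [MeasurableSpace β] [MeasurableSpace γ]
    {Z : Ω → ℝ}
    (hind : Indep (MeasurableSpace.comap Z inferInstance) 𝓖 P) {A : Ω → β}
    (hA : Measurable[𝓖] A) {k : ℝ → γ} (hk : Measurable k) :
    IndepFun A (fun ω => k (Z ω)) P := by
  rw [IndepFun_iff_Indep]
  refine indep_of_indep_of_le_left (indep_of_indep_of_le_right hind.symm ?_) hA.comap_le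
  rintro _ ⟨s, hs, rfl⟩
  exact ⟨k ⁻¹' s, hk hs, rfl⟩

lemma memLp_two_mul_of_indepFun {A B : Ω → ℝ} (h : IndepFun A B P) (hA : MemLp A 2 P)
    (hB : MemLp B 2 P) : MemLp (fun ω => A ω * B ω) 2 P := by
  refine (memLp_two_iff_integrable_sq (hA.1.mul hB.1)).2 ?_
  have := (h.comp (measurable_id.pow_const 2) (measurable_id.pow_const 2)).integrable_mul
    hA.integrable_sq hB.integrable_sq
  exact this.congr (.of_forall fun ω => by simp [mul_pow])

/-- `E[A² B²] = E[A²] E[B²]` with `E[B²] > 0`, so finiteness passes to `E[A²]`. This recovers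
integrability of positions from integrability of gains. -/
lemma memLp_two_left_of_mul {A B : Ω → ℝ} (h : IndepFun A B P) (hA : AEStronglyMeasurable A P)
    (hB : AEStronglyMeasurable B P) (hB0 : ¬ B =ᵐ[P] 0)
    (hAB : MemLp (fun ω => A ω * B ω) 2 P) : MemLp A 2 P := by
  rw [memLp_two_iff_integrable_sq hA]
  have hi := hAB.integrable_sq
  refine (h.comp (measurable_id.pow_const 2)
    (measurable_id.pow_const 2)).integrable_left_of_integrable_op (· * ·) 1 one_ne_zero
    (fun x y => by simp [enorm_mul]) (hi.congr (.of_forall fun ω => by simp [mul_pow]))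
    (by simpa using! hA.pow 2) (by simpa using! hB.pow 2) fun h0 => hB0 ?_
  filter_upwards [h0] with ω hω
  simpa using hω

/-- If `Y` is `𝓖`-measurable, `Z` is independent of `𝓖` and `E[ψ(y, Z)] = 0` for all `y`, then
`E[ψ(Y, Z) | 𝓖] = 0`. -/
lemma condExp_eq_zero_of_indep [IsProbabilityMeasure P] (h𝓖 : 𝓖 ≤ mΩ)
    {Y Z : Ω → ℝ} (hY : Measurable[𝓖] Y) (hZ : Measurable Z)
    (hind : Indep (MeasurableSpace.comap Z inferInstance) 𝓖 P) {ψ : ℝ × ℝ → ℝ}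
    (hψ : Measurable ψ) (hint : Integrable (fun ω => ψ (Y ω, Z ω)) P)
    (h0 : ∀ y, ∫ ω, ψ (y, Z ω) ∂P = 0) :
    P[fun ω => ψ (Y ω, Z ω) | 𝓖] =ᵐ[P] 0 := by
  refine (ae_eq_condExp_of_forall_setIntegral_eq h𝓖 hint
    (fun s _ _ => (integrable_zero Ω ℝ P).integrableOn) (fun s hs _ => ?_)
    aestronglyMeasurable_zero).symm
  have hs' : MeasurableSet s := h𝓖 s hs
  -- The test set is bundled with `Y` into one `𝓖`-measurable variable, so the law of `(W, Z)` is a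
  -- product and Fubini can integrate `Z` out at frozen `w`.
  let W : Ω → ℝ × ℝ := fun ω => (Y ω, s.indicator (fun _ => 1) ω)
  have hW : Measurable[𝓖] W := hY.prodMk (measurable_const.indicator hs)
  have hW' : Measurable W := hW.mono h𝓖 le_rfl
  have hWZ : IndepFun W (fun ω => id (Z ω)) P := indepFun_of_indep_comap hind hW measurable_id
  have hmap := hWZ.map_prod_eq_prod_map_map hW'.aemeasurable hZ.aemeasurable
  let Φ : (ℝ × ℝ) × ℝ → ℝ := fun p => p.1.2 * ψ (p.1.1, p.2)
  have hΦ : Measurable Φ := by fun_prop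
  have hrew : ∀ ω, s.indicator (fun ω => ψ (Y ω, Z ω)) ω = Φ (W ω, Z ω) := fun ω => by
    by_cases h : ω ∈ s <;> simp [Φ, W, h]
  have hpair : Measurable fun ω => (W ω, Z ω) := hW'.prodMk hZ
  have hΦi : Integrable Φ ((P.map W).prod (P.map Z)) := by
    rw [show (P.map W).prod (P.map Z) = P.map (fun ω => (W ω, Z ω)) from hmap.symm,
      integrable_map_measure hΦ.aestronglyMeasurable hpair.aemeasurable]
    exact (hint.indicator hs').congr (.of_forall hrew)
  have : ∫ ω in s, ψ (Y ω, Z ω) ∂P = 0 := by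
    rw [← integral_indicator hs', integral_congr_ae (.of_forall hrew),
      ← integral_map hpair.aemeasurable hΦ.aestronglyMeasurable,
      show P.map (fun ω => (W ω, Z ω)) = (P.map W).prod (P.map Z) from hmap,
      integral_prod _ hΦi]
    refine integral_eq_zero_of_ae (.of_forall fun w => ?_)
    have hsec : Measurable fun z => ψ (w.1, z) := hψ.comp (measurable_const.prodMk measurable_id)
    change ∫ z, w.2 * ψ (w.1, z) ∂(P.map Z) = 0
    rw [integral_const_mul, integral_map hZ.aemeasurable hsec.aestronglyMeasurable, h0, mul_zero]
  simp [this]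

end Independence

/-! ### Exponential moments of independent increments -/

section Increments

variable {Ω : Type*} {mΩ : MeasurableSpace Ω} {P : Measure Ω} {F : Filtration ℕ mΩ} {N : ℕ}
  {X : ℕ → Ω → ℝ}

lemma HasIndepIncrementsUpTo.measurable_incr (hX : HasIndepIncrementsUpTo P F N X) {n : ℕ}
    (hn : n ≤ N) : Measurable[F n] (incr X n) :=
  (hX.adapted n hn).sub ((hX.adapted (n - 1) ((Nat.sub_le n 1).trans hn)).mono
    (F.mono (Nat.sub_le n 1)) le_rfl)

lemma HasIndepIncrementsUpTo.indepFun (hX : HasIndepIncrementsUpTo P F N X) {n : ℕ}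
    (h1 : 1 ≤ n) (hn : n ≤ N) {A : Ω → ℝ} (hA : Measurable[F (n - 1)] A) {k : ℝ → ℝ}
    (hk : Measurable k) : IndepFun A (fun ω => k (incr X n ω)) P :=
  indepFun_of_indep_comap (hX.indep n h1 hn) hA hk

lemma HasIndepIncrementsUpTo.integral_mul (hX : HasIndepIncrementsUpTo P F N X) {n : ℕ}
    (h1 : 1 ≤ n) (hn : n ≤ N) {A : Ω → ℝ} (hA : Measurable[F (n - 1)] A) {k : ℝ → ℝ}
    (hk : Measurable k) :
    ∫ ω, A ω * k (incr X n ω) ∂P = (∫ ω, A ω ∂P) * ∫ ω, k (incr X n ω) ∂P :=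
  (hX.indepFun h1 hn hA hk).integral_fun_mul_eq_mul_integral
    (hA.mono (F.le _) le_rfl).aestronglyMeasurable
    (hk.comp ((hX.measurable_incr hn).mono (F.le _) le_rfl)).aestronglyMeasurable

/-- `exp(t X_n)` is a product of independent factors that never vanish; integrability of such a
product forces that of each factor. -/
lemma HasIndepIncrementsUpTo.integrable_exp_step [IsProbabilityMeasure P]
    (hX : HasIndepIncrementsUpTo P F N X) {t : ℝ}
    {n : ℕ} (h1 : 1 ≤ n) (hn : n ≤ N) (h : Integrable (fun ω => Real.exp (t * X n ω)) P) :
    Integrable (fun ω => Real.exp (t * X (n - 1) ω)) P ∧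
      Integrable (fun ω => Real.exp (t * incr X n ω)) P := by
  have hm := (hX.adapted (n - 1) ((Nat.sub_le n 1).trans hn))
  have hA : Measurable[F (n - 1)] fun ω => Real.exp (t * X (n - 1) ω) :=
    Real.measurable_exp.comp (hm.const_mul t)
  have hk : Measurable fun x : ℝ => Real.exp (t * x) := by fun_prop
  have hind := hX.indepFun h1 hn hA hk
  have hA' := (hA.mono (F.le _) le_rfl).aestronglyMeasurable (μ := P)
  have hB' := (hk.comp ((hX.measurable_incr hn).mono (F.le _) le_rfl)).aestronglyMeasurable (μ := P)
  have hprod : Integrable (fun ω => Real.exp (t * X (n - 1) ω) * Real.exp (t * incr X n ω)) P :=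
    h.congr (.of_forall fun ω => by simp only [incr]; rw [← Real.exp_add]; ring_nf)
  have hne : ∀ Y : Ω → ℝ, ¬ (fun ω => Real.exp (Y ω)) =ᵐ[P] 0 := fun Y h0 => by
    obtain ⟨ω, hω⟩ := h0.exists
    exact (Real.exp_pos _).ne' hω
  refine ⟨hind.integrable_left_of_integrable_op (· * ·) 1 one_ne_zero
    (fun x y => by simp [enorm_mul]) hprod hA' hB' (hne _),
    hind.integrable_right_of_integrable_op (· * ·) 1 one_ne_zero
    (fun x y => by simp [enorm_mul]) hprod hA' hB' (hne _)⟩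

lemma HasIndepIncrementsUpTo.integrable_exp [IsProbabilityMeasure P]
    (hX : HasIndepIncrementsUpTo P F N X) {t : ℝ}
    (h : Integrable (fun ω => Real.exp (t * X N ω)) P) :
    (∀ n ≤ N, Integrable (fun ω => Real.exp (t * X n ω)) P) ∧
      ∀ n, 1 ≤ n → n ≤ N → Integrable (fun ω => Real.exp (t * incr X n ω)) P := by
  -- Only the terminal moment is assumed, so the induction runs backwards from `N`.
  have key : ∀ k ≤ N, Integrable (fun ω => Real.exp (t * X (N - k) ω)) P := by
    intro k
    induction k with
    | zero => exact fun _ => h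
    | succ k ih =>
      intro hk
      have := (hX.integrable_exp_step (n := N - k) (by omega) (by omega) (ih (by omega))).1
      rwa [Nat.sub_sub] at this
  have key' : ∀ n ≤ N, Integrable (fun ω => Real.exp (t * X n ω)) P := fun n hn => by
    have := key (N - n) (Nat.sub_le _ _)
    rwa [Nat.sub_sub_self hn] at this
  exact ⟨key', fun n h1 hn => (hX.integrable_exp_step h1 hn (key' n hn)).2⟩

lemma memLp_two_exp {Y : Ω → ℝ} (hY : Measurable Y) {t : ℝ}
    (h : Integrable (fun ω => Real.exp (2 * t * Y ω)) P) :
    MemLp (fun ω => Real.exp (t * Y ω)) 2 P := by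
  rw [memLp_two_iff_integrable_sq (by fun_prop)]
  refine h.congr (.of_forall fun ω => ?_)
  simp only
  rw [← Real.exp_nat_mul]
  push_cast
  ring_nf

lemma mem_expDomain_ofReal {t : ℝ} : ((t : ℝ) : ℂ) ∈ expDomain P N X ↔
    Integrable (fun ω => Real.exp (t * X N ω)) P := by
  have : (fun ω => Complex.exp ((t : ℂ) * (X N ω : ℂ))) =
      fun ω => ((Real.exp (t * X N ω) : ℝ) : ℂ) := by
    ext ω
    push_cast
    rfl
  simp only [expDomain, Set.mem_ofPred_eq, this]
  exact ⟨fun h => by simpa only [RCLike.re_eq_complex_re, Complex.ofReal_re] using h.re, fun h => h.ofReal⟩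

end Increments

/-! ### Simple returns and their first two moments -/

section Returns

variable {Ω : Type*} {mΩ : MeasurableSpace Ω} {P : Measure Ω} {F : Filtration ℕ mΩ} {N : ℕ}
  {X : ℕ → Ω → ℝ}

/-- The simple return `S_n / S_{n-1} - 1 = exp(ΔX_n) - 1`. -/
noncomputable def ret (X : ℕ → Ω → ℝ) (n : ℕ) (ω : Ω) : ℝ := Real.exp (incr X n ω) - 1

lemma incr_price (s₀ : ℝ) (X : ℕ → Ω → ℝ) (n : ℕ) (ω : Ω) :
    incr (price s₀ X) n ω = price s₀ X (n - 1) ω * ret X n ω := by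
  have : Real.exp (X n ω) = Real.exp (X (n - 1) ω) * Real.exp (incr X n ω) := by
    rw [← Real.exp_add]; simp [incr]
  simp only [incr, price, ret] at *
  rw [this]
  ring

lemma price_pos {s₀ : ℝ} (hs₀ : 0 < s₀) (n : ℕ) (ω : Ω) : 0 < price s₀ X n ω :=
  mul_pos hs₀ (Real.exp_pos _)

lemma HasIndepIncrementsUpTo.measurable_price (hX : HasIndepIncrementsUpTo P F N X) (s₀ : ℝ)
    {n : ℕ} (hn : n ≤ N) : Measurable[F n] (price s₀ X n) :=
  (Real.measurable_exp.comp (hX.adapted n hn)).const_mul s₀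

/-- Independent, nondegenerate increments with square integrable exponentials. -/
structure IsRegularMarket (P : Measure Ω) (F : Filtration ℕ mΩ) (N : ℕ) (X : ℕ → Ω → ℝ) :
    Prop where
  indepIncr : HasIndepIncrementsUpTo P F N X
  memLp_exp : ∀ n ≤ N, MemLp (fun ω => Real.exp (X n ω)) 2 P
  memLp_ret : ∀ n, 1 ≤ n → n ≤ N → MemLp (ret X n) 2 P
  nondegenerate : ∀ n, 1 ≤ n → n ≤ N → ¬ ∃ c : ℝ, ∀ᵐ ω ∂P, incr X n ω = c

lemma IsRegularMarket.of_mem_expDomain [IsProbabilityMeasure P]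
    (hX : HasIndepIncrementsUpTo P F N X) (h2 : (2 : ℂ) ∈ expDomain P N X)
    (hnd : ∀ n, 1 ≤ n → n ≤ N → ¬ ∃ c : ℝ, ∀ᵐ ω ∂P, incr X n ω = c) :
    IsRegularMarket P F N X := by
  have h2' : Integrable (fun ω => Real.exp (2 * X N ω)) P :=
    mem_expDomain_ofReal.1 (by exact_mod_cast h2)
  obtain ⟨hS, hD⟩ := hX.integrable_exp h2'
  refine ⟨hX, fun n hn => ?_, fun n h1 hn => ?_, hnd⟩
  · simpa using memLp_two_exp (t := 1) ((hX.adapted n hn).mono (F.le _) le_rfl)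
      (by simpa using hS n hn)
  · have := memLp_two_exp (t := 1) ((hX.measurable_incr hn).mono (F.le _) le_rfl)
      (by simpa using hD n h1 hn)
    simp only [one_mul] at this
    exact this.sub (memLp_const 1)

variable [IsProbabilityMeasure P] (hM : IsRegularMarket P F N X) {n : ℕ} (h1 : 1 ≤ n) (hn : n ≤ N)

lemma HasIndepIncrementsUpTo.measurable_ret (hX : HasIndepIncrementsUpTo P F N X) {n : ℕ}
    (hn : n ≤ N) : Measurable[F n] (ret X n) :=
  (Real.measurable_exp.comp (hX.measurable_incr hn)).sub_const 1

/-- The expected return. -/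
noncomputable def retMean (P : Measure Ω) (X : ℕ → Ω → ℝ) (n : ℕ) : ℝ := ∫ ω, ret X n ω ∂P

/-- The second moment of the return. -/
noncomputable def retSq (P : Measure Ω) (X : ℕ → Ω → ℝ) (n : ℕ) : ℝ := ∫ ω, ret X n ω ^ 2 ∂P

include hM h1 hn

lemma IsRegularMarket.integrable_ret : Integrable (ret X n) P :=
  (hM.memLp_ret n h1 hn).integrable (by norm_num)

lemma IsRegularMarket.integral_ret_sub_sq :
    ∫ ω, (ret X n ω - retMean P X n) ^ 2 ∂P = retSq P X n - retMean P X n ^ 2 := by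
  have h2 := (hM.memLp_ret n h1 hn).integrable_sq
  have hi := hM.integrable_ret h1 hn
  have : ∀ ω, (ret X n ω - retMean P X n) ^ 2 =
      (ret X n ω ^ 2 - 2 * retMean P X n * ret X n ω) + retMean P X n ^ 2 := fun ω => by ring
  have h3 : Integrable (fun ω => ret X n ω ^ 2 - 2 * retMean P X n * ret X n ω) P :=
    h2.sub (hi.const_mul _)
  simp_rw [this]
  rw [integral_add h3 (integrable_const _),
    integral_sub h2 (hi.const_mul _), integral_const_mul]
  simp only [integral_const, probReal_univ, smul_eq_mul, one_mul]
  change retSq P X n - 2 * retMean P X n * retMean P X n + retMean P X n ^ 2 = _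
  ring

/-- Zero variance would make the return almost surely constant, hence also its logarithm `ΔX_n =
log(1 + r_n)`. -/
lemma IsRegularMarket.retVar_pos : 0 < retSq P X n - retMean P X n ^ 2 := by
  rw [← hM.integral_ret_sub_sq h1 hn]
  have hi : Integrable (fun ω => (ret X n ω - retMean P X n) ^ 2) P :=
    ((hM.memLp_ret n h1 hn).sub (memLp_const (retMean P X n))).integrable_sq
  have h0 : 0 ≤ fun ω => (ret X n ω - retMean P X n) ^ 2 := fun ω => sq_nonneg _
  refine lt_of_le_of_ne (integral_nonneg h0) fun h => hM.nondegenerate n h1 hn ?_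
  have := (integral_eq_zero_iff_of_nonneg h0 hi).1 h.symm
  refine ⟨Real.log (retMean P X n + 1), ?_⟩
  filter_upwards [this] with ω hω
  have h2 : ret X n ω = retMean P X n := by
    have := pow_eq_zero_iff (two_ne_zero) |>.1 hω
    linarith
  rw [← h2, ret, sub_add_cancel, Real.log_exp]

lemma IsRegularMarket.retSq_pos : 0 < retSq P X n := by
  nlinarith [hM.retVar_pos h1 hn, sq_nonneg (retMean P X n)]

lemma IsRegularMarket.ret_not_ae_zero : ¬ ret X n =ᵐ[P] 0 := fun h => by
  refine hM.nondegenerate n h1 hn ⟨0, ?_⟩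
  filter_upwards [h] with ω hω
  simpa [ret, sub_eq_zero] using hω

lemma IsRegularMarket.integrable_exp_incr : Integrable (fun ω => Real.exp (incr X n ω)) P := by
  have := (hM.integrable_ret h1 hn).add (integrable_const (1 : ℝ))
  exact this.congr (.of_forall fun ω => by simp [ret])

lemma IsRegularMarket.m_one : m P X 1 n = ((retMean P X n + 1 : ℝ) : ℂ) := by
  have h := complexMGF_ofReal (X := incr X n) (μ := P) 1
  rw [Complex.ofReal_one] at h
  rw [m, h, mgf, retMean, ← sub_eq_iff_eq_add.1]
  simp only [ret, one_mul]
  rw [integral_sub (hM.integrable_exp_incr h1 hn) (integrable_const _)]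
  simp

lemma IsRegularMarket.m_two : m P X 2 n = ((retSq P X n + 2 * retMean P X n + 1 : ℝ) : ℂ) := by
  have h := complexMGF_ofReal (X := incr X n) (μ := P) 2
  rw [show ((2 : ℝ) : ℂ) = 2 by norm_num] at h
  rw [m, h, mgf, retMean, retSq]
  congr 1
  have h2 := (hM.memLp_ret n h1 hn).integrable_sq
  have hi := hM.integrable_ret h1 hn
  have : ∀ ω, Real.exp (2 * incr X n ω) = ret X n ω ^ 2 + 2 * ret X n ω + 1 := fun ω => by
    rw [two_mul, Real.exp_add, ret]; ring
  have h3 : Integrable (fun ω => ret X n ω ^ 2 + 2 * ret X n ω) P := h2.add (hi.const_mul _)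
  simp_rw [this]
  rw [integral_add h3 (integrable_const _),
    integral_add h2 (hi.const_mul _), integral_const_mul]
  simp

/-- `m(2, n) - 2 m(1, n) + 1` is `E[r_n²]`, so up to the price `λ_n` is the deterministic
coefficient in the regression, without intercept, of the constant `1` on `r_n`. -/
lemma IsRegularMarket.price_mul_lam {s₀ : ℝ} (hs₀ : 0 < s₀) (ω : Ω) :
    lam P s₀ X n ω * price s₀ X (n - 1) ω = retMean P X n / retSq P X n := by
  have := (price_pos (X := X) hs₀ (n - 1) ω).ne'
  rw [lam, hM.m_one h1 hn, hM.m_two h1 hn, Complex.ofReal_re, Complex.ofReal_re]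
  rw [mul_right_comm, one_div_mul_cancel this, one_mul]
  congr 1 <;> ring

lemma IsRegularMarket.integral_mul_ret {A : Ω → ℝ} (hA : Measurable[F (n - 1)] A) :
    ∫ ω, A ω * ret X n ω ∂P = (∫ ω, A ω ∂P) * retMean P X n :=
  hM.indepIncr.integral_mul h1 hn hA (k := fun x => Real.exp x - 1) (by fun_prop)

lemma IsRegularMarket.memLp_mul_ret {A : Ω → ℝ} (hA : Measurable[F (n - 1)] A)
    (hA2 : MemLp A 2 P) : MemLp (fun ω => A ω * ret X n ω) 2 P :=
  memLp_two_mul_of_indepFun (hM.indepIncr.indepFun h1 hn hA (k := fun x => Real.exp x - 1)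
    (by fun_prop)) hA2 (hM.memLp_ret n h1 hn)

lemma IsRegularMarket.memLp_of_mul_ret {A : Ω → ℝ} (hA : Measurable[F (n - 1)] A)
    (hA2 : MemLp (fun ω => A ω * ret X n ω) 2 P) : MemLp A 2 P :=
  memLp_two_left_of_mul (hM.indepIncr.indepFun h1 hn hA (k := fun x => Real.exp x - 1)
    (by fun_prop)) (hA.mono (F.le _) le_rfl).aestronglyMeasurable
    (hM.memLp_ret n h1 hn).1 (hM.ret_not_ae_zero h1 hn) hA2

lemma IsRegularMarket.integral_mul_ret_sq {A : Ω → ℝ} (hA : Measurable[F (n - 1)] A) :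
    ∫ ω, A ω * ret X n ω ^ 2 ∂P = (∫ ω, A ω ∂P) * retSq P X n :=
  hM.indepIncr.integral_mul h1 hn hA (k := fun x => (Real.exp x - 1) ^ 2) (by fun_prop)

lemma IsRegularMarket.condExp_incr_price {s₀ : ℝ} :
    P[price s₀ X n - price s₀ X (n - 1) | F (n - 1)] =ᵐ[P]
      fun ω => price s₀ X (n - 1) ω * retMean P X n := by
  have hn' : n - 1 ≤ N := (Nat.sub_le n 1).trans hn
  have hpm := hM.indepIncr.measurable_price s₀ hn'
  have hp2 : MemLp (price s₀ X (n - 1)) 2 P := (hM.memLp_exp _ hn').const_mul s₀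
  have heq : price s₀ X n - price s₀ X (n - 1) = price s₀ X (n - 1) * ret X n := by
    ext ω
    exact incr_price s₀ X n ω
  rw [heq]
  refine (condExp_mul_of_stronglyMeasurable_left hpm.stronglyMeasurable
    ((hM.memLp_mul_ret h1 hn hpm hp2).integrable (by norm_num)) (hM.integrable_ret h1 hn)).trans ?_
  have hk : Measurable fun x : ℝ => Real.exp x - 1 := by fun_prop
  have hsm : StronglyMeasurable[MeasurableSpace.comap (incr X n) inferInstance] (ret X n) :=
    (hk.comp (comap_measurable (incr X n))).stronglyMeasurable
  have := condExp_indep_eq ((hM.indepIncr.measurable_incr hn).mono (F.le _) le_rfl).comap_le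
    (F.le (n - 1)) hsm (hM.indepIncr.indep n h1 hn)
  filter_upwards [this] with ω hω
  simp [hω, retMean]

end Returns

/-! ### The Doob martingale part of the price -/

section MartingalePart

variable {Ω : Type*} {mΩ : MeasurableSpace Ω} {P : Measure Ω} {F : Filtration ℕ mΩ} {N : ℕ}
  {X : ℕ → Ω → ℝ} [IsProbabilityMeasure P]

lemma martingalePart_sub_pred (S : ℕ → Ω → ℝ) {n : ℕ} (h1 : 1 ≤ n) :
    martingalePart S F P n - martingalePart S F P (n - 1) =
      (S n - S (n - 1)) - P[S n - S (n - 1) | F (n - 1)] := by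
  obtain ⟨k, rfl⟩ : ∃ k, n = k + 1 := ⟨n - 1, by omega⟩
  simp only [martingalePart, predictablePart, Finset.sum_range_succ, Nat.add_sub_cancel]
  abel

lemma condExp_incr_martingalePart {S : ℕ → Ω → ℝ} {n : ℕ} (h1 : 1 ≤ n)
    (hi : Integrable (S n - S (n - 1)) P) :
    P[martingalePart S F P n - martingalePart S F P (n - 1) | F (n - 1)] =ᵐ[P] 0 := by
  rw [martingalePart_sub_pred _ h1]
  refine (condExp_sub hi integrable_condExp _).trans ?_
  filter_upwards [condExp_condExp_of_le (f := S n - S (n - 1)) (μ := P)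
    (le_refl (F (n - 1))) (F.le (n - 1))] with ω hω
  rw [Pi.sub_apply, hω, sub_self, Pi.zero_apply]

lemma stronglyMeasurable_martingalePart {S : ℕ → Ω → ℝ} {n : ℕ}
    (hS : StronglyMeasurable[F n] (S n)) : StronglyMeasurable[F n] (martingalePart S F P n) := by
  refine hS.sub (Finset.stronglyMeasurable_sum _ fun i hi => ?_)
  exact stronglyMeasurable_condExp.mono (F.mono (Finset.mem_range.1 hi).le)

lemma memLp_martingalePart {S : ℕ → Ω → ℝ} (hS : ∀ n ≤ N, MemLp (S n) 2 P) {n : ℕ} (hn : n ≤ N) :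
    MemLp (martingalePart S F P n) 2 P := by
  refine (hS n hn).sub (memLp_finsetSum' _ fun i hi => ?_)
  have := Finset.mem_range.1 hi
  exact ((hS _ (by omega)).sub (hS _ (by omega))).condExp (by norm_num)

lemma IsRegularMarket.incr_martingalePart (hM : IsRegularMarket P F N X) {n : ℕ} (h1 : 1 ≤ n)
    (hn : n ≤ N) (s₀ : ℝ) :
    martingalePart (price s₀ X) F P n - martingalePart (price s₀ X) F P (n - 1) =ᵐ[P]
      fun ω => price s₀ X (n - 1) ω * (ret X n ω - retMean P X n) := by
  rw [martingalePart_sub_pred _ h1]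
  filter_upwards [hM.condExp_incr_price h1 hn (s₀ := s₀)] with ω hω
  rw [Pi.sub_apply, hω, Pi.sub_apply]
  have := incr_price s₀ X n ω
  rw [incr] at this
  rw [this]
  ring

/-- Only the product `T D` has to be integrable, not `T`; this allows test variables such as `q /
S_{n-1}`. -/
lemma integral_mul_eq_zero_of_condExp_eq_zero {𝓖 : MeasurableSpace Ω} (h𝓖 : 𝓖 ≤ mΩ)
    {T D : Ω → ℝ} (hD : Integrable D P) (h0 : P[D | 𝓖] =ᵐ[P] 0) (hT : Measurable[𝓖] T)
    (hTD : Integrable (fun ω => T ω * D ω) P) : ∫ ω, T ω * D ω ∂P = 0 := by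
  rw [← integral_condExp h𝓖]
  refine integral_eq_zero_of_ae ?_
  refine (condExp_mul_of_stronglyMeasurable_left hT.stronglyMeasurable hTD hD).trans ?_
  filter_upwards [h0] with ω hω
  simp [hω]

end MartingalePart

/-! ### Orthogonality of `L` to returns -/

section Orthogonality

variable {Ω : Type*} {mΩ : MeasurableSpace Ω} {P : Measure Ω} {F : Filtration ℕ mΩ} {N : ℕ}
  {X : ℕ → Ω → ℝ} [IsProbabilityMeasure P] {s₀ : ℝ} {H : Ω → ℝ} {H₀ : ℝ} {ξ L : ℕ → Ω → ℝ}
  {n : ℕ}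

lemma IsMartingaleUpTo.condExp_incr {Y : ℕ → Ω → ℝ} (hY : IsMartingaleUpTo P F N Y) {n : ℕ}
    (hn : n ≤ N) : P[Y n - Y (n - 1) | F (n - 1)] =ᵐ[P] 0 := by
  have hn' : n - 1 ≤ N := (Nat.sub_le n 1).trans hn
  refine (condExp_sub (hY.integrable n hn) (hY.integrable _ hn') _).trans ?_
  have h1 := hY.condExp_eq (n - 1) n (Nat.sub_le n 1) hn
  have h2 := hY.condExp_eq (n - 1) (n - 1) le_rfl hn'
  filter_upwards [h1, h2] with ω e1 e2
  simp [e1, e2]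

variable (hM : IsRegularMarket P F N X) (hs₀ : 0 < s₀)
  (hD : IsRealFSDecomposition P F N (price s₀ X) H H₀ ξ L) (hn : n ≤ N)

include hD hn

lemma IsRealFSDecomposition.memLp_incr : MemLp (fun ω => L n ω - L (n - 1) ω) 2 P :=
  (hD.square_integrable n hn).sub (hD.square_integrable _ ((Nat.sub_le n 1).trans hn))

lemma IsRealFSDecomposition.integral_mul_incr {T : Ω → ℝ} (hT : Measurable[F (n - 1)] T)
    (hT2 : MemLp T 2 P) : ∫ ω, T ω * (L n ω - L (n - 1) ω) ∂P = 0 :=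
  integral_mul_eq_zero_of_condExp_eq_zero (F.le (n - 1))
    ((hD.memLp_incr hn).integrable (by norm_num)) (hD.martingale.condExp_incr hn) hT
    (hT2.integrable_mul (hD.memLp_incr hn))

include hM

/-- `ΔL ΔM = Δ(L M) - L_{n-1} ΔM - M_{n-1} ΔL`, and each term on the right has zero conditional
expectation. -/
lemma IsRealFSDecomposition.condExp_incr_mul_incr (h1 : 1 ≤ n) :
    P[(L n - L (n - 1)) *
      (martingalePart (price s₀ X) F P n - martingalePart (price s₀ X) F P (n - 1)) |
        F (n - 1)] =ᵐ[P] 0 := by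
  have hn' : n - 1 ≤ N := (Nat.sub_le n 1).trans hn
  set M := martingalePart (price s₀ X) F P with hMdef
  have hS : ∀ k ≤ N, MemLp (price s₀ X k) 2 P := fun k hk => (hM.memLp_exp k hk).const_mul s₀
  have hM2 : ∀ k ≤ N, MemLp (M k) 2 P := fun k hk => memLp_martingalePart hS hk
  have hMm : StronglyMeasurable[F (n - 1)] (M (n - 1)) :=
    stronglyMeasurable_martingalePart (hM.indepIncr.measurable_price s₀ hn').stronglyMeasurable
  have hLm := hD.martingale.adapted (n - 1) hn'
  have hL2 := hD.square_integrable
  have hdM : P[M n - M (n - 1) | F (n - 1)] =ᵐ[P] 0 := condExp_incr_martingalePart h1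
    (((hS n hn).sub (hS _ hn')).integrable (by norm_num))
  have hdM2 : MemLp (M n - M (n - 1)) 2 P := (hM2 n hn).sub (hM2 _ hn')
  have hdL2 : MemLp (L n - L (n - 1)) 2 P := (hL2 n hn).sub (hL2 _ hn')
  have hA := condExp_mul_of_stronglyMeasurable_left hLm ((hL2 _ hn').integrable_mul hdM2)
    (hdM2.integrable (by norm_num))
  have hB := condExp_mul_of_stronglyMeasurable_left hMm ((hM2 _ hn').integrable_mul hdL2)
    (hdL2.integrable (by norm_num))
  have hC := hD.orthogonal.condExp_incr hn
  have heq : (L n - L (n - 1)) * (M n - M (n - 1)) =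
      ((fun ω => L n ω * M n ω) - fun ω => L (n - 1) ω * M (n - 1) ω) -
        (L (n - 1) * (M n - M (n - 1)) + M (n - 1) * (L n - L (n - 1))) := by
    ext ω
    simp only [Pi.mul_apply, Pi.sub_apply, Pi.add_apply]
    ring
  have hi1 : Integrable ((fun ω => L n ω * M n ω) - fun ω => L (n - 1) ω * M (n - 1) ω) P :=
    ((hL2 n hn).integrable_mul (hM2 n hn)).sub ((hL2 _ hn').integrable_mul (hM2 _ hn'))
  have hi2 := (hL2 _ hn').integrable_mul hdM2
  have hi3 := (hM2 _ hn').integrable_mul hdL2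
  rw [heq]
  refine (condExp_sub hi1 (hi2.add hi3) _).trans ?_
  filter_upwards [condExp_add hi2 hi3 (F (n - 1)), hA, hB, hC, hdM,
    hD.martingale.condExp_incr hn] with ω e1 e2 e3 e4 e5 e6
  rw [Pi.sub_apply, e1, Pi.add_apply, e2, e3, e4]
  simp [e5, e6]

include hs₀

/-- Since `ΔM_n = S_{n-1} (r_n - E[r_n])`, testing with `q / S_{n-1}` turns orthogonality to `M`
into orthogonality to the centred return. The mean part drops out because `L` is a martingale. -/
lemma IsRealFSDecomposition.integral_mul_ret_mul_incr (h1 : 1 ≤ n) {q : Ω → ℝ}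
    (hq : Measurable[F (n - 1)] q) (hq2 : MemLp q 2 P) :
    ∫ ω, q ω * ret X n ω * (L n ω - L (n - 1) ω) ∂P = 0 := by
  have hn' : n - 1 ≤ N := (Nat.sub_le n 1).trans hn
  have hpm := hM.indepIncr.measurable_price s₀ hn'
  have hS : ∀ k ≤ N, MemLp (price s₀ X k) 2 P := fun k hk => (hM.memLp_exp k hk).const_mul s₀
  have hqr := hM.memLp_mul_ret h1 hn hq hq2
  have hdM2 : MemLp (martingalePart (price s₀ X) F P n -
      martingalePart (price s₀ X) F P (n - 1)) 2 P :=
    (memLp_martingalePart hS hn).sub (memLp_martingalePart hS hn')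
  have hae : (fun ω => q ω * (ret X n ω - retMean P X n) * (L n ω - L (n - 1) ω)) =ᵐ[P]
      fun ω => q ω / price s₀ X (n - 1) ω * ((L n - L (n - 1)) *
      (martingalePart (price s₀ X) F P n - martingalePart (price s₀ X) F P (n - 1))) ω := by
    filter_upwards [hM.incr_martingalePart h1 hn s₀] with ω hω
    rw [Pi.mul_apply, hω, Pi.sub_apply]
    have := (price_pos (X := X) hs₀ (n - 1) ω).ne'
    field_simp
  have hi1 : Integrable (fun ω => q ω * ret X n ω * (L n ω - L (n - 1) ω)) P :=
    hqr.integrable_mul (hD.memLp_incr hn)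
  have hi2 : Integrable (fun ω => retMean P X n * (q ω * (L n ω - L (n - 1) ω))) P :=
    (hq2.integrable_mul (hD.memLp_incr hn)).const_mul _
  have hi : Integrable (fun ω => q ω * (ret X n ω - retMean P X n) * (L n ω - L (n - 1) ω)) P :=
    (hi1.sub hi2).congr (.of_forall fun ω => by simp only [Pi.sub_apply]; ring)
  have h0 : ∫ ω, q ω * (ret X n ω - retMean P X n) * (L n ω - L (n - 1) ω) ∂P = 0 := by
    rw [integral_congr_ae hae]
    exact integral_mul_eq_zero_of_condExp_eq_zero (F.le (n - 1))
      ((hD.memLp_incr hn).integrable_mul hdM2) (hD.condExp_incr_mul_incr hM hn h1)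
      (hq.div hpm) (hi.congr hae)
  have hsplit : ∀ ω, q ω * ret X n ω * (L n ω - L (n - 1) ω) =
      q ω * (ret X n ω - retMean P X n) * (L n ω - L (n - 1) ω) +
        retMean P X n * (q ω * (L n ω - L (n - 1) ω)) := fun ω => by ring
  simp_rw [hsplit]
  rw [integral_add hi hi2, h0, integral_const_mul, hD.integral_mul_incr hn hq hq2]
  simp

end Orthogonality

/-! ### Orthogonality of the hedging residual -/

section Residual

variable {Ω : Type*} {mΩ : MeasurableSpace Ω} {P : Measure Ω} {F : Filtration ℕ mΩ} {N : ℕ}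
  {X : ℕ → Ω → ℝ} [IsProbabilityMeasure P] {s₀ : ℝ} {H : Ω → ℝ} {H₀ : ℝ} {ξ L : ℕ → Ω → ℝ}
  {R : ℕ → Ω → ℝ}

/-- `R_n = R_{n-1} (1 - (E[r_n] / E[r_n²]) r_n) + ΔL_n` with `r_n` the simple returns: the dynamics
of the residual `H_n - H_0 - G_n(φ)` for the optimal strategy `φ`. -/
structure IsResidual (P : Measure Ω) (F : Filtration ℕ mΩ) (N : ℕ) (X L R : ℕ → Ω → ℝ) :
    Prop where
  zero : R 0 = L 0
  adapted : ∀ n ≤ N, Measurable[F n] (R n)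
  step : ∀ n, 1 ≤ n → n ≤ N → ∀ ω, R n ω =
    R (n - 1) ω - retMean P X n / retSq P X n * (R (n - 1) ω * ret X n ω) +
      (L n ω - L (n - 1) ω)

variable (hR : IsResidual P F N X L R) (hM : IsRegularMarket P F N X) (hs₀ : 0 < s₀)
  (hD : IsRealFSDecomposition P F N (price s₀ X) H H₀ ξ L)

include hR hM hD

lemma IsResidual.memLp : ∀ n ≤ N, MemLp (R n) 2 P := by
  intro n
  induction n with
  | zero => intro hn; rw [hR.zero]; exact hD.square_integrable 0 hn
  | succ n ih =>
    intro hn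
    have hn' : n ≤ N := by omega
    have e := hR.step (n + 1) (by omega) hn
    simp only [Nat.add_sub_cancel] at e
    rw [funext e]
    exact ((ih hn').sub ((hM.memLp_mul_ret (n := n + 1) (by omega) hn (hR.adapted n hn')
      (ih hn')).const_mul _)).add (hD.memLp_incr hn)

/-- By independence of `r_n`, `E[R_n T] = (1 - E[r_n]² / E[r_n²]) E[R_{n-1} T]`: one period only
rescales the pairing with a variable known beforehand. -/
lemma IsResidual.integral_mul_step {n : ℕ} (h1 : 1 ≤ n) (hn : n ≤ N) {T : Ω → ℝ}
    (hT : Measurable[F (n - 1)] T) (hT2 : MemLp T 2 P) (h0 : ∫ ω, R (n - 1) ω * T ω ∂P = 0) :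
    ∫ ω, R n ω * T ω ∂P = 0 := by
  have hn' : n - 1 ≤ N := (Nat.sub_le n 1).trans hn
  have hR2 := hR.memLp hM hD (n - 1) hn'
  have hRT : Measurable[F (n - 1)] fun ω => R (n - 1) ω * T ω := (hR.adapted _ hn').mul hT
  have hRr := hM.memLp_mul_ret h1 hn (hR.adapted _ hn') hR2
  have hi1 : Integrable (fun ω => R (n - 1) ω * T ω) P := hR2.integrable_mul hT2
  have hi2 : Integrable (fun ω => R (n - 1) ω * T ω * ret X n ω) P :=
    (hRr.integrable_mul hT2).congr (.of_forall fun ω => by simp only [Pi.mul_apply]; ring)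
  have hi2' := hi2.const_mul (retMean P X n / retSq P X n)
  have hi3 : Integrable (fun ω => T ω * (L n ω - L (n - 1) ω)) P :=
    hT2.integrable_mul (hD.memLp_incr hn)
  have hsplit : ∀ ω, R n ω * T ω = R (n - 1) ω * T ω -
      retMean P X n / retSq P X n * (R (n - 1) ω * T ω * ret X n ω) +
        T ω * (L n ω - L (n - 1) ω) := fun ω => by
    rw [hR.step n h1 hn ω]; ring
  have hi12 : Integrable (fun ω => R (n - 1) ω * T ω -
      retMean P X n / retSq P X n * (R (n - 1) ω * T ω * ret X n ω)) P := hi1.sub hi2'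
  simp_rw [hsplit]
  rw [integral_add hi12 hi3, integral_sub hi1 hi2', integral_const_mul,
    hM.integral_mul_ret h1 hn hRT, h0, hD.integral_mul_incr hn hT hT2]
  simp

lemma IsResidual.integral_mul_eq_zero_of_le {k n : ℕ} (hkn : k ≤ n) (hn : n ≤ N) {T : Ω → ℝ}
    (hT : Measurable[F k] T) (hT2 : MemLp T 2 P) (h0 : ∫ ω, R k ω * T ω ∂P = 0) :
    ∫ ω, R n ω * T ω ∂P = 0 := by
  induction n, hkn using Nat.le_induction with
  | base => exact h0
  | succ n hkn ih =>
    exact hR.integral_mul_step hM hD (by omega) hn (hT.mono (F.mono (by omega)) le_rfl) hT2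
      (ih (by omega))

lemma IsResidual.integral_terminal : ∫ ω, R N ω ∂P = 0 := by
  -- The normalisation `E[L_0] = 0` enters here.
  have h0 : ∫ ω, R 0 ω * (1 : ℝ) ∂P = 0 := by
    simpa [hR.zero] using hD.expectation_zero
  simpa using hR.integral_mul_eq_zero_of_le hM hD (Nat.zero_le N) le_rfl (T := fun _ => 1)
    measurable_const (memLp_const 1) h0

include hs₀

/-- The ratio `E[r_n] / E[r_n²]` is what makes `1 - (E[r_n] / E[r_n²]) r_n` orthogonal to `r_n`; the
`ΔL_n` term vanishes by the decomposition. -/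
lemma IsResidual.integral_mul_ret {n : ℕ} (h1 : 1 ≤ n) (hn : n ≤ N) {q : Ω → ℝ}
    (hq : Measurable[F (n - 1)] q) (hq2 : MemLp q 2 P) :
    ∫ ω, R n ω * (q ω * ret X n ω) ∂P = 0 := by
  have hn' : n - 1 ≤ N := (Nat.sub_le n 1).trans hn
  have hR2 := hR.memLp hM hD (n - 1) hn'
  have hRq : Measurable[F (n - 1)] fun ω => R (n - 1) ω * q ω := (hR.adapted _ hn').mul hq
  have hRr := hM.memLp_mul_ret h1 hn (hR.adapted _ hn') hR2
  have hqr := hM.memLp_mul_ret h1 hn hq hq2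
  have hi1 : Integrable (fun ω => R (n - 1) ω * q ω * ret X n ω) P :=
    (hRr.integrable_mul hq2).congr (.of_forall fun ω => by simp only [Pi.mul_apply]; ring)
  have hi2 : Integrable (fun ω => R (n - 1) ω * q ω * ret X n ω ^ 2) P :=
    (hRr.integrable_mul hqr).congr (.of_forall fun ω => by simp only [Pi.mul_apply]; ring)
  have hi2' := hi2.const_mul (retMean P X n / retSq P X n)
  have hi3 : Integrable (fun ω => q ω * ret X n ω * (L n ω - L (n - 1) ω)) P :=
    hqr.integrable_mul (hD.memLp_incr hn)
  have hsplit : ∀ ω, R n ω * (q ω * ret X n ω) = R (n - 1) ω * q ω * ret X n ω -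
      retMean P X n / retSq P X n * (R (n - 1) ω * q ω * ret X n ω ^ 2) +
        q ω * ret X n ω * (L n ω - L (n - 1) ω) := fun ω => by
    rw [hR.step n h1 hn ω]; ring
  have hi12 : Integrable (fun ω => R (n - 1) ω * q ω * ret X n ω -
      retMean P X n / retSq P X n * (R (n - 1) ω * q ω * ret X n ω ^ 2)) P := hi1.sub hi2'
  have hpos := (hM.retSq_pos h1 hn).ne'
  simp_rw [hsplit]
  rw [integral_add hi12 hi3, integral_sub hi1 hi2', integral_const_mul,
    hM.integral_mul_ret h1 hn hRq, hM.integral_mul_ret_sq h1 hn hRq,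
    hD.integral_mul_ret_mul_incr hM hs₀ hn h1 hq hq2]
  field_simp
  ring

lemma IsResidual.integral_terminal_mul_ret {n : ℕ} (h1 : 1 ≤ n) (hn : n ≤ N) {q : Ω → ℝ}
    (hq : Measurable[F (n - 1)] q) (hq2 : MemLp q 2 P) :
    ∫ ω, R N ω * (q ω * ret X n ω) ∂P = 0 :=
  hR.integral_mul_eq_zero_of_le hM hD hn le_rfl
    ((hq.mono (F.mono (Nat.sub_le n 1)) le_rfl).mul (hM.indepIncr.measurable_ret hn))
    (hM.memLp_mul_ret h1 hn hq hq2) (hR.integral_mul_ret hM hs₀ hD h1 hn hq hq2)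

end Residual

/-! ### Linear independence of constants and returns -/

section Uniqueness

variable {Ω : Type*} {mΩ : MeasurableSpace Ω} {P : Measure Ω} {F : Filtration ℕ mΩ} {N : ℕ}
  {X : ℕ → Ω → ℝ} [IsProbabilityMeasure P]

lemma IsRegularMarket.memLp_affine (hM : IsRegularMarket P F N X) {q : ℕ → Ω → ℝ} (v : ℝ)
    {n : ℕ} (hn : n ≤ N)
    (hq : ∀ k ∈ Finset.Icc 1 n, Measurable[F (k - 1)] (q k) ∧ MemLp (q k) 2 P) :
    MemLp (fun ω => v + ∑ k ∈ Finset.Icc 1 n, q k ω * ret X k ω) 2 P := by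
  refine (memLp_const v).add (memLp_finsetSum _ fun k hk => ?_)
  have := Finset.mem_Icc.1 hk
  exact hM.memLp_mul_ret this.1 (this.2.trans hn) (hq k hk).1 (hq k hk).2

lemma IsRegularMarket.measurable_affine (hM : IsRegularMarket P F N X) {q : ℕ → Ω → ℝ} (v : ℝ)
    {n : ℕ} (hn : n ≤ N) (hq : ∀ k ∈ Finset.Icc 1 n, Measurable[F (k - 1)] (q k)) :
    Measurable[F n] (fun ω => v + ∑ k ∈ Finset.Icc 1 n, q k ω * ret X k ω) := by
  refine Measurable.const_add (Finset.measurable_sum _ fun k hk => ?_) v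
  have := Finset.mem_Icc.1 hk
  exact ((hq k hk).mono (F.mono (by omega)) le_rfl).mul
    ((hM.indepIncr.measurable_ret (this.2.trans hn)).mono (F.mono this.2) le_rfl)

/-- Testing the relation against `q` and against `q r_n` gives two linear equations in `E[U q]` and
`E[q²]`; eliminating the former leaves `E[q²] Var(r_n) = 0`. -/
lemma IsRegularMarket.eq_zero_of_add_mul_ret (hM : IsRegularMarket P F N X) {n : ℕ} (h1 : 1 ≤ n)
    (hn : n ≤ N) {U q : Ω → ℝ} (hU : Measurable[F (n - 1)] U) (hU2 : MemLp U 2 P)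
    (hq : Measurable[F (n - 1)] q) (hq2 : MemLp q 2 P)
    (h : ∀ᵐ ω ∂P, U ω + q ω * ret X n ω = 0) : U =ᵐ[P] 0 ∧ q =ᵐ[P] 0 := by
  have hUq : Measurable[F (n - 1)] fun ω => U ω * q ω := hU.mul hq
  have hqq : Measurable[F (n - 1)] fun ω => q ω * q ω := hq.mul hq
  have hqr := hM.memLp_mul_ret h1 hn hq hq2
  have j1 : Integrable (fun ω => U ω * q ω) P := hU2.integrable_mul hq2
  have j2 : Integrable (fun ω => U ω * q ω * ret X n ω) P :=
    (hU2.integrable_mul hqr).congr (.of_forall fun ω => by simp only [Pi.mul_apply]; ring)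
  have j3 : Integrable (fun ω => q ω * q ω * ret X n ω) P :=
    (hq2.integrable_mul hqr).congr (.of_forall fun ω => by simp only [Pi.mul_apply]; ring)
  have j4 : Integrable (fun ω => q ω * q ω * ret X n ω ^ 2) P :=
    (hqr.integrable_mul hqr).congr (.of_forall fun ω => by simp only [Pi.mul_apply]; ring)
  have e1 : ∫ ω, (U ω * q ω + q ω * q ω * ret X n ω) ∂P = 0 := by
    refine integral_eq_zero_of_ae ?_
    filter_upwards [h] with ω hω
    simp only [Pi.zero_apply]
    linear_combination q ω * hω
  have e2 : ∫ ω, (U ω * q ω * ret X n ω + q ω * q ω * ret X n ω ^ 2) ∂P = 0 := by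
    refine integral_eq_zero_of_ae ?_
    filter_upwards [h] with ω hω
    simp only [Pi.zero_apply]
    linear_combination q ω * ret X n ω * hω
  rw [integral_add j1 j3, hM.integral_mul_ret h1 hn hqq] at e1
  rw [integral_add j2 j4, hM.integral_mul_ret h1 hn hUq, hM.integral_mul_ret_sq h1 hn hqq] at e2
  have hvar := hM.retVar_pos h1 hn
  have hq0 : ∫ ω, q ω * q ω ∂P = 0 := by
    have : (∫ ω, q ω * q ω ∂P) * (retSq P X n - retMean P X n ^ 2) = 0 := by
      linear_combination e2 - retMean P X n * e1
    exact (mul_eq_zero.1 this).resolve_right hvar.ne'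
  have hq' : q =ᵐ[P] 0 := by
    have := (integral_eq_zero_iff_of_nonneg (fun ω => mul_self_nonneg (q ω))
      (hq2.integrable_mul hq2)).1 hq0
    filter_upwards [this] with ω hω
    exact mul_self_eq_zero.1 hω
  refine ⟨?_, hq'⟩
  filter_upwards [h, hq'] with ω hω hω'
  simpa [hω'] using hω

/-- The sum without its last term is known one period earlier and plays the role of `U`; its
vanishing feeds the induction. -/
lemma IsRegularMarket.eq_zero_of_affine (hM : IsRegularMarket P F N X) {q : ℕ → Ω → ℝ} {v : ℝ}
    {n : ℕ} (hn : n ≤ N)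
    (hq : ∀ k ∈ Finset.Icc 1 n, Measurable[F (k - 1)] (q k) ∧ MemLp (q k) 2 P)
    (h : ∀ᵐ ω ∂P, v + ∑ k ∈ Finset.Icc 1 n, q k ω * ret X k ω = 0) :
    v = 0 ∧ ∀ k ∈ Finset.Icc 1 n, q k =ᵐ[P] 0 := by
  induction n with
  | zero =>
    obtain ⟨ω, hω⟩ := h.exists
    exact ⟨by simpa using hω, by simp⟩
  | succ n ih =>
    have hsub : ∀ k ∈ Finset.Icc 1 n, k ∈ Finset.Icc 1 (n + 1) := fun k hk => by
      have := Finset.mem_Icc.1 hk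
      exact Finset.mem_Icc.2 ⟨this.1, by omega⟩
    have hlast : n + 1 ∈ Finset.Icc 1 (n + 1) := Finset.mem_Icc.2 ⟨by omega, le_rfl⟩
    have hn' : n ≤ N := by omega
    have hq' : ∀ k ∈ Finset.Icc 1 n, Measurable[F (k - 1)] (q k) ∧ MemLp (q k) 2 P :=
      fun k hk => hq k (hsub k hk)
    have h' : ∀ᵐ ω ∂P, (v + ∑ k ∈ Finset.Icc 1 n, q k ω * ret X k ω) +
        q (n + 1) ω * ret X (n + 1) ω = 0 := by
      filter_upwards [h] with ω hω
      rwa [Finset.sum_Icc_succ_top (by omega), ← add_assoc] at hω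
    obtain ⟨hU, hl⟩ := hM.eq_zero_of_add_mul_ret (by omega) hn
      (hM.measurable_affine v hn' fun k hk => (hq' k hk).1) (hM.memLp_affine v hn' hq')
      (hq _ hlast).1 (hq _ hlast).2 h'
    obtain ⟨hv, hk⟩ := ih hn' hq' hU
    refine ⟨hv, fun k hk' => ?_⟩
    rcases (Finset.mem_Icc.1 hk').2.eq_or_lt with rfl | hlt
    · exact hl
    · exact hk k (Finset.mem_Icc.2 ⟨(Finset.mem_Icc.1 hk').1, by omega⟩)

end Uniqueness

/-! ### The optimal strategy: admissibility, Pythagoras, uniqueness -/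

section Optimality

variable {Ω : Type*} {mΩ : MeasurableSpace Ω} {P : Measure Ω} {F : Filtration ℕ mΩ} {N : ℕ}
  {X : ℕ → Ω → ℝ} {s₀ : ℝ} {H : Ω → ℝ} {H₀ : ℝ} {ξ L : ℕ → Ω → ℝ}

/-- The gains of the optimal strategy, defined recursively. -/
noncomputable def optGains (P : Measure Ω) (s₀ : ℝ) (X : ℕ → Ω → ℝ) (H₀ : ℝ) (ξ L : ℕ → Ω → ℝ) :
    ℕ → Ω → ℝ
  | 0 => fun _ => 0
  | n + 1 => fun ω => optGains P s₀ X H₀ ξ L n ω +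
      (ξ (n + 1) ω + lam P s₀ X (n + 1) ω * (fsValue (price s₀ X) H₀ ξ L n ω - H₀ -
        optGains P s₀ X H₀ ξ L n ω)) * incr (price s₀ X) (n + 1) ω

/-- The strategy `φ_n = ξ_n + λ_n (H_{n-1} - H_0 - G_{n-1}(φ))`. -/
noncomputable def optStrategy (P : Measure Ω) (s₀ : ℝ) (X : ℕ → Ω → ℝ) (H₀ : ℝ)
    (ξ L : ℕ → Ω → ℝ) (n : ℕ) (ω : Ω) : ℝ :=
  ξ n ω + lam P s₀ X n ω * (fsValue (price s₀ X) H₀ ξ L (n - 1) ω - H₀ -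
    optGains P s₀ X H₀ ξ L (n - 1) ω)

lemma gains_succ (S φ : ℕ → Ω → ℝ) (n : ℕ) (ω : Ω) :
    gains S φ (n + 1) ω = gains S φ n ω + φ (n + 1) ω * incr S (n + 1) ω := by
  rw [gains, Finset.sum_Icc_succ_top (by omega), gains]

/-- The gains are built first and the strategy is read off from them; this closes the loop, so the
strategy satisfies its implicit feedback equation. -/
lemma gains_optStrategy (n : ℕ) (ω : Ω) :
    gains (price s₀ X) (optStrategy P s₀ X H₀ ξ L) n ω = optGains P s₀ X H₀ ξ L n ω := by
  induction n with
  | zero => simp [gains, optGains]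
  | succ n ih => rw [gains_succ, ih, optGains, optStrategy, Nat.add_sub_cancel]

variable [IsProbabilityMeasure P] (hM : IsRegularMarket P F N X)

include hM in
lemma IsRegularMarket.measurable_gains {φ : ℕ → Ω → ℝ}
    (hφ : ∀ k, 1 ≤ k → k ≤ N → Measurable[F (k - 1)] (φ k)) {n : ℕ} (hn : n ≤ N) :
    Measurable[F n] (gains (price s₀ X) φ n) := by
  refine Finset.measurable_sum _ fun k hk => ?_
  have hk' := Finset.mem_Icc.1 hk
  have hp := hM.indepIncr.measurable_price s₀ (hk'.2.trans hn)
  have hp' := hM.indepIncr.measurable_price s₀ (n := k - 1) (by omega)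
  exact ((hφ k hk'.1 (hk'.2.trans hn)).mono (F.mono (by omega)) le_rfl).mul
    ((hp.mono (F.mono hk'.2) le_rfl).sub (hp'.mono (F.mono (by omega)) le_rfl))

lemma gains_price (φ : ℕ → Ω → ℝ) (n : ℕ) (ω : Ω) : gains (price s₀ X) φ n ω =
    ∑ k ∈ Finset.Icc 1 n, φ k ω * price s₀ X (k - 1) ω * ret X k ω :=
  Finset.sum_congr rfl fun k _ => by rw [incr_price, mul_assoc]

lemma IsAdmissible.memLp_gains {S φ : ℕ → Ω → ℝ} (h : IsAdmissible P F N S φ) {n : ℕ}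
    (hn : n ≤ N) : MemLp (gains S φ n) 2 P :=
  memLp_finsetSum _ fun k hk => h.square_integrable k (Finset.mem_Icc.1 hk).1
    ((Finset.mem_Icc.1 hk).2.trans hn)

variable (hs₀ : 0 < s₀)

include hM hs₀

lemma IsRegularMarket.measurable_lam {n : ℕ} (h1 : 1 ≤ n) (hn : n ≤ N) :
    Measurable[F (n - 1)] (lam P s₀ X n) := by
  have hp := hM.indepIncr.measurable_price s₀ (n := n - 1) (by omega)
  exact (measurable_const.div hp).mul measurable_const

/-- `φ_n ΔS_n` is the amount `φ_n S_{n-1}` times an independent nonzero return, so the amount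
inherits square integrability. -/
lemma IsAdmissible.memLp_mul_price {φ : ℕ → Ω → ℝ} (h : IsAdmissible P F N (price s₀ X) φ)
    {n : ℕ} (h1 : 1 ≤ n) (hn : n ≤ N) :
    Measurable[F (n - 1)] (fun ω => φ n ω * price s₀ X (n - 1) ω) ∧
      MemLp (fun ω => φ n ω * price s₀ X (n - 1) ω) 2 P := by
  have hm : Measurable[F (n - 1)] (fun ω => φ n ω * price s₀ X (n - 1) ω) :=
    (h.predictable n h1 hn).mul (hM.indepIncr.measurable_price s₀ (by omega))
  refine ⟨hm, hM.memLp_of_mul_ret h1 hn hm ?_⟩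
  refine (h.square_integrable n h1 hn).ae_eq (.of_forall fun ω => ?_)
  simp only [incr_price, mul_assoc]

variable (hD : IsRealFSDecomposition P F N (price s₀ X) H H₀ ξ L)

include hD

/-- Strategy and gains feed each other, gains at `n` into the position at `n + 1` and back, so both
are handled in one induction. -/
lemma IsRealFSDecomposition.measurable_optStrategy :
    (∀ n, 1 ≤ n → n ≤ N → Measurable[F (n - 1)] (optStrategy P s₀ X H₀ ξ L n)) ∧
      ∀ n ≤ N, Measurable[F n] (optGains P s₀ X H₀ ξ L n) := by
  have hV : ∀ n ≤ N, Measurable[F n] (fsValue (price s₀ X) H₀ ξ L n) := fun n hn =>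
    ((hM.measurable_gains hD.admissible.predictable hn).const_add H₀).add
      (hD.martingale.adapted n hn).measurable
  have hG : ∀ n ≤ N, Measurable[F n] (optGains P s₀ X H₀ ξ L n) →
      ∀ _ : n + 1 ≤ N, Measurable[F n] (optStrategy P s₀ X H₀ ξ L (n + 1)) := fun n hn h hn1 =>
    (hD.admissible.predictable (n + 1) (by omega) hn1).add
      ((hM.measurable_lam hs₀ (n := n + 1) (by omega) hn1).mul (((hV n hn).sub_const H₀).sub h))
  have hO : ∀ n ≤ N, Measurable[F n] (optGains P s₀ X H₀ ξ L n) := by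
    intro n
    induction n with
    | zero => exact fun _ => measurable_const
    | succ n ih =>
      intro hn
      have hp := hM.indepIncr.measurable_price s₀ hn
      have hp' := hM.indepIncr.measurable_price s₀ (n := n) (by omega)
      have hle : F n ≤ F (n + 1) := F.mono (Nat.le_succ n)
      exact ((ih (by omega)).mono hle le_rfl).add
        (((hG n (by omega) (ih (by omega)) hn).mono hle le_rfl).mul (hp.sub (hp'.mono hle le_rfl)))
  refine ⟨fun n h1 hn => ?_, hO⟩
  obtain ⟨k, rfl⟩ : ∃ k, n = k + 1 := ⟨n - 1, by omega⟩
  exact hG k (by omega) (hO k (by omega)) hn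

lemma IsRealFSDecomposition.isResidual :
    IsResidual P F N X L fun n ω =>
      fsValue (price s₀ X) H₀ ξ L n ω - H₀ - optGains P s₀ X H₀ ξ L n ω where
  zero := by
    ext ω
    simp [fsValue, gains, optGains]
  adapted n hn :=
    ((((hM.measurable_gains hD.admissible.predictable hn).const_add H₀).add
      (hD.martingale.adapted n hn).measurable).sub_const H₀).sub
      ((hD.measurable_optStrategy hM hs₀).2 n hn)
  step n h1 hn ω := by
    obtain ⟨k, rfl⟩ : ∃ k, n = k + 1 := ⟨n - 1, by omega⟩
    rw [← hM.price_mul_lam h1 hn hs₀ ω]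
    simp only [fsValue, gains_succ, optGains, Nat.add_sub_cancel, incr_price]
    ring

/-- `φ_n ΔS_n = ξ_n ΔS_n + (E[r_n] / E[r_n²]) R_{n-1} r_n`, and the residual is already square
integrable. -/
lemma IsRealFSDecomposition.isAdmissible_optStrategy :
    IsAdmissible P F N (price s₀ X) (optStrategy P s₀ X H₀ ξ L) where
  predictable := (hD.measurable_optStrategy hM hs₀).1
  square_integrable n h1 hn := by
    have hR := hD.isResidual hM hs₀
    have := (hD.admissible.square_integrable n h1 hn).add
      ((hM.memLp_mul_ret h1 hn (hR.adapted (n - 1) (by omega))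
        (hR.memLp hM hD (n - 1) (by omega))).const_mul (retMean P X n / retSq P X n))
    refine this.ae_eq (.of_forall fun ω => ?_)
    rw [← hM.price_mul_lam h1 hn hs₀ ω]
    simp only [Pi.add_apply, optStrategy, incr_price]
    ring

/-- The Pythagorean identity for the hedging errors. -/
lemma IsRealFSDecomposition.hedgingError_eq {V : ℝ} {ψ : ℕ → Ω → ℝ}
    (hψ : IsAdmissible P F N (price s₀ X) ψ) :
    hedgingError P N (price s₀ X) H V ψ =
      hedgingError P N (price s₀ X) H H₀ (optStrategy P s₀ X H₀ ξ L) +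
        ∫ ω, ((H₀ - V) + ∑ k ∈ Finset.Icc 1 N,
          ((optStrategy P s₀ X H₀ ξ L k ω - ψ k ω) * price s₀ X (k - 1) ω) * ret X k ω) ^ 2 ∂P := by
  have hφ := hD.isAdmissible_optStrategy hM hs₀
  have hR := hD.isResidual hM hs₀
  set φ := optStrategy P s₀ X H₀ ξ L with hφdef
  set R : Ω → ℝ := fun ω => fsValue (price s₀ X) H₀ ξ L N ω - H₀ - optGains P s₀ X H₀ ξ L N ω
    with hRdef
  set q : ℕ → Ω → ℝ := fun k ω => (φ k ω - ψ k ω) * price s₀ X (k - 1) ω with hqdef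
  have hq : ∀ k ∈ Finset.Icc 1 N, Measurable[F (k - 1)] (q k) ∧ MemLp (q k) 2 P := by
    intro k hk
    have hk' := Finset.mem_Icc.1 hk
    have a1 := hφ.memLp_mul_price hM hs₀ hk'.1 hk'.2
    have a2 := hψ.memLp_mul_price hM hs₀ hk'.1 hk'.2
    have : q k = fun ω => φ k ω * price s₀ X (k - 1) ω - ψ k ω * price s₀ X (k - 1) ω := by
      ext ω; simp only [hqdef]; ring
    rw [this]
    exact ⟨a1.1.sub a2.1, a1.2.sub a2.2⟩
  have hW := hM.memLp_affine (H₀ - V) le_rfl hq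
  have hR2 : MemLp R 2 P := hR.memLp hM hD N le_rfl
  -- The cross term: two competitors differ by a constant plus gains, to which the terminal residual
  -- is orthogonal.
  have hRW : ∫ ω, R ω * ((H₀ - V) + ∑ k ∈ Finset.Icc 1 N, q k ω * ret X k ω) ∂P = 0 := by
    have hterm : ∀ k ∈ Finset.Icc 1 N, Integrable (fun ω => R ω * (q k ω * ret X k ω)) P :=
      fun k hk => hR2.integrable_mul (hM.memLp_mul_ret (Finset.mem_Icc.1 hk).1
        (Finset.mem_Icc.1 hk).2 (hq k hk).1 (hq k hk).2)
    simp_rw [mul_add, Finset.mul_sum]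
    rw [integral_add ((hR2.integrable (by norm_num)).mul_const _) (integrable_finsetSum _ hterm),
      integral_mul_const, integral_finsetSum _ hterm]
    rw [show ∫ ω, R ω ∂P = 0 from hR.integral_terminal hM hD, zero_mul, zero_add]
    exact Finset.sum_eq_zero fun k hk => hR.integral_terminal_mul_ret hM hs₀ hD
      (Finset.mem_Icc.1 hk).1 (Finset.mem_Icc.1 hk).2 (hq k hk).1 (hq k hk).2
  have e1 : hedgingError P N (price s₀ X) H H₀ φ = ∫ ω, R ω ^ 2 ∂P := by
    refine integral_congr_ae ?_
    filter_upwards [hD.decomposition] with ω hω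
    rw [hω, hφdef, gains_optStrategy, hRdef]
    simp only [fsValue]
  have e2 : hedgingError P N (price s₀ X) H V ψ =
      ∫ ω, (R ω + ((H₀ - V) + ∑ k ∈ Finset.Icc 1 N, q k ω * ret X k ω)) ^ 2 ∂P := by
    refine integral_congr_ae ?_
    filter_upwards [hD.decomposition] with ω hω
    have : ∑ k ∈ Finset.Icc 1 N, q k ω * ret X k ω =
        gains (price s₀ X) φ N ω - gains (price s₀ X) ψ N ω := by
      rw [gains_price, gains_price, ← Finset.sum_sub_distrib]
      exact Finset.sum_congr rfl fun k _ => by simp only [hqdef]; ring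
    rw [hω, this, hφdef, gains_optStrategy, hRdef]
    simp only [fsValue]
    ring
  rw [e1, e2]
  have hi1 := hR2.integrable_sq
  have hi2 := hW.integrable_sq
  have hi3 : Integrable (fun ω => 2 * (R ω *
      ((H₀ - V) + ∑ k ∈ Finset.Icc 1 N, q k ω * ret X k ω))) P := (hR2.integrable_mul hW).const_mul 2
  have hi13 : Integrable (fun ω => R ω ^ 2 + 2 * (R ω *
      ((H₀ - V) + ∑ k ∈ Finset.Icc 1 N, q k ω * ret X k ω))) P := hi1.add hi3
  have hsq : ∀ ω, (R ω + ((H₀ - V) + ∑ k ∈ Finset.Icc 1 N, q k ω * ret X k ω)) ^ 2 =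
      (R ω ^ 2 + 2 * (R ω * ((H₀ - V) + ∑ k ∈ Finset.Icc 1 N, q k ω * ret X k ω))) +
        ((H₀ - V) + ∑ k ∈ Finset.Icc 1 N, q k ω * ret X k ω) ^ 2 := fun ω => by ring
  simp_rw [hsq]
  rw [integral_add hi13 hi2, integral_add hi1 hi3, integral_const_mul, hRW]
  simp only [mul_zero, add_zero, hqdef]

/-- Every Föllmer-Schweizer decomposition gives the unique optimal hedge. -/
theorem IsRealFSDecomposition.isOptimal_optStrategy :
    IsOptimal P F N (price s₀ X) H H₀ (optStrategy P s₀ X H₀ ξ L) ∧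
      ∀ (V : ℝ) (ψ : ℕ → Ω → ℝ), IsOptimal P F N (price s₀ X) H V ψ →
        V = H₀ ∧ ∀ n, 1 ≤ n → n ≤ N → ∀ᵐ ω ∂P, ψ n ω = optStrategy P s₀ X H₀ ξ L n ω := by
  have hφ := hD.isAdmissible_optStrategy hM hs₀
  refine ⟨⟨hφ, fun V ψ hψ => ?_⟩, fun V ψ hψ => ?_⟩
  · rw [hD.hedgingError_eq hM hs₀ hψ]
    exact le_add_of_nonneg_right (integral_nonneg fun ω => sq_nonneg _)
  · have hle := hψ.minimal H₀ _ hφ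
    rw [hD.hedgingError_eq hM hs₀ hψ.admissible] at hle
    have hq : ∀ k ∈ Finset.Icc 1 N, Measurable[F (k - 1)] (fun ω =>
        (optStrategy P s₀ X H₀ ξ L k ω - ψ k ω) * price s₀ X (k - 1) ω) ∧ MemLp (fun ω =>
        (optStrategy P s₀ X H₀ ξ L k ω - ψ k ω) * price s₀ X (k - 1) ω) 2 P := by
      intro k hk
      have hk' := Finset.mem_Icc.1 hk
      have a1 := hφ.memLp_mul_price hM hs₀ hk'.1 hk'.2
      have a2 := hψ.admissible.memLp_mul_price hM hs₀ hk'.1 hk'.2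
      simp only [sub_mul]
      exact ⟨a1.1.sub a2.1, a1.2.sub a2.2⟩
    have hW := hM.memLp_affine (H₀ - V) le_rfl hq
    -- A second minimizer makes the extra square in the Pythagorean identity integrate to zero.
    have hz := le_antisymm ((add_le_iff_nonpos_right _).1 hle)
      (integral_nonneg fun ω => sq_nonneg _)
    have hz' := (integral_eq_zero_iff_of_nonneg (fun ω => sq_nonneg _) hW.integrable_sq).1 hz
    obtain ⟨hv, hk⟩ := hM.eq_zero_of_affine le_rfl hq (by
      filter_upwards [hz'] with ω hω
      exact pow_eq_zero_iff (two_ne_zero) |>.1 hω)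
    refine ⟨by linarith, fun n h1 hn => ?_⟩
    filter_upwards [hk n (Finset.mem_Icc.2 ⟨h1, hn⟩)] with ω hω
    have := (mul_eq_zero.1 hω).resolve_right (price_pos hs₀ _ _).ne'
    linarith

end Optimality

/-! ### From one-period equations to a decomposition -/

section Construction

variable {Ω : Type*} {mΩ : MeasurableSpace Ω} {P : Measure Ω} {F : Filtration ℕ mΩ} {N : ℕ}
  {X : ℕ → Ω → ℝ} [IsProbabilityMeasure P] {s₀ : ℝ}

lemma IsMartingaleUpTo.of_condExp_incr {Y : ℕ → Ω → ℝ}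
    (hm : ∀ n ≤ N, StronglyMeasurable[F n] (Y n)) (hi : ∀ n ≤ N, Integrable (Y n) P)
    (h : ∀ n, 1 ≤ n → n ≤ N → P[Y n - Y (n - 1) | F (n - 1)] =ᵐ[P] 0) :
    IsMartingaleUpTo P F N Y where
  adapted := hm
  integrable := hi
  condExp_eq k n hkn hn := by
    induction n, hkn using Nat.le_induction with
    | base => rw [condExp_of_stronglyMeasurable (F.le k) (hm k hn) (hi k hn)]
    | succ n hkn ih =>
      have hn' : n ≤ N := by omega
      have hstep : P[Y (n + 1) | F n] =ᵐ[P] Y n := by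
        have h0 := h (n + 1) (by omega) hn
        simp only [Nat.add_sub_cancel] at h0
        have h1 := condExp_sub (hi (n + 1) hn) (hi n hn') (F n)
        filter_upwards [h0, h1] with ω e0 e1
        rw [e1, Pi.sub_apply, condExp_of_stronglyMeasurable (F.le n) (hm n hn') (hi n hn'),
          Pi.zero_apply] at e0
        linarith
      exact (condExp_condExp_of_le (F.mono hkn) (F.le n)).symm.trans
        ((condExp_congr_ae hstep).trans (ih hn'))

/-- The logarithmic price `log S_n`. -/
noncomputable def logPrice (s₀ : ℝ) (X : ℕ → Ω → ℝ) (n : ℕ) (ω : Ω) : ℝ := Real.log s₀ + X n ω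

lemma exp_logPrice (hs₀ : 0 < s₀) (n : ℕ) (ω : Ω) :
    Real.exp (logPrice s₀ X n ω) = price s₀ X n ω := by
  rw [logPrice, Real.exp_add, Real.exp_log hs₀, price]

lemma logPrice_pred_add_incr (n : ℕ) (ω : Ω) :
    logPrice s₀ X (n - 1) ω + incr X n ω = logPrice s₀ X n ω := by
  simp [logPrice, incr]

lemma HasIndepIncrementsUpTo.measurable_logPrice (hX : HasIndepIncrementsUpTo P F N X) {n : ℕ}
    (hn : n ≤ N) : Measurable[F n] (logPrice s₀ X n) :=
  (hX.adapted n hn).const_add _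

/-- The increment `v_n(x + d) - v_{n-1}(x) - w_n(x) (e^d - 1)` of the martingale of a decomposition
with value functions `v` and hedge amounts `w`, in logarithmic prices. -/
noncomputable def hedgeIncr (v w : ℕ → ℝ → ℝ) (n : ℕ) (x d : ℝ) : ℝ :=
  v n (x + d) - v (n - 1) x - w n x * (Real.exp d - 1)

/-- Value functions `v` and hedge amounts `w` (in logarithmic prices) satisfying the one-period
Föllmer-Schweizer equations. -/
structure IsHedgingSystem (P : Measure Ω) (N : ℕ) (s₀ : ℝ) (X : ℕ → Ω → ℝ) (v w : ℕ → ℝ → ℝ) :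
    Prop where
  measurable_value : ∀ n ≤ N, Measurable (v n)
  measurable_hedge : ∀ n, 1 ≤ n → n ≤ N → Measurable (w n)
  memLp_value : ∀ n ≤ N, MemLp (fun ω => v n (logPrice s₀ X n ω)) 2 P
  memLp_hedge : ∀ n, 1 ≤ n → n ≤ N → MemLp (fun ω => w n (logPrice s₀ X (n - 1) ω)) 2 P
  integral_eq_zero : ∀ n, 1 ≤ n → n ≤ N → ∀ x, ∫ ω, hedgeIncr v w n x (incr X n ω) ∂P = 0
  integral_mul_eq_zero : ∀ n, 1 ≤ n → n ≤ N → ∀ x,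
    ∫ ω, hedgeIncr v w n x (incr X n ω) * (ret X n ω - retMean P X n) ∂P = 0

variable (hM : IsRegularMarket P F N X) (hs₀ : 0 < s₀) {v w : ℕ → ℝ → ℝ}
  (hS : IsHedgingSystem P N s₀ X v w)

/-- The hedge `ξ_n = w_n(log S_{n-1}) / S_{n-1}`. -/
noncomputable def systemHedge (s₀ : ℝ) (X : ℕ → Ω → ℝ) (w : ℕ → ℝ → ℝ) (n : ℕ) (ω : Ω) : ℝ :=
  w n (logPrice s₀ X (n - 1) ω) / price s₀ X (n - 1) ω

/-- The martingale `L_n = v_n(log S_n) - v_0(log s_0) - G_n(ξ)`. -/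
noncomputable def systemMartingale (s₀ : ℝ) (X : ℕ → Ω → ℝ) (v w : ℕ → ℝ → ℝ) (n : ℕ) (ω : Ω) : ℝ :=
  v n (logPrice s₀ X n ω) - v 0 (Real.log s₀) - gains (price s₀ X) (systemHedge s₀ X w) n ω

lemma fsValue_system (n : ℕ) (ω : Ω) :
    fsValue (price s₀ X) (v 0 (Real.log s₀)) (systemHedge s₀ X w) (systemMartingale s₀ X v w) n ω =
      v n (logPrice s₀ X n ω) := by
  simp only [fsValue, systemMartingale]
  ring

include hs₀ in
lemma systemHedge_mul_incr (n : ℕ) (ω : Ω) :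
    systemHedge s₀ X w n ω * incr (price s₀ X) n ω =
      w n (logPrice s₀ X (n - 1) ω) * ret X n ω := by
  have := (price_pos (X := X) hs₀ (n - 1) ω).ne'
  rw [systemHedge, incr_price]
  field_simp

include hs₀ in
-- The past enters only through the previous log price, the form needed for the freezing lemma.
lemma systemMartingale_sub_pred {n : ℕ} (h1 : 1 ≤ n) (ω : Ω) :
    systemMartingale s₀ X v w n ω - systemMartingale s₀ X v w (n - 1) ω =
      hedgeIncr v w n (logPrice s₀ X (n - 1) ω) (incr X n ω) := by
  have h := systemHedge_mul_incr (w := w) (X := X) hs₀ n ω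
  rw [hedgeIncr, logPrice_pred_add_incr]
  obtain ⟨k, rfl⟩ : ∃ k, n = k + 1 := ⟨n - 1, by omega⟩
  simp only [systemMartingale, gains_succ, h, Nat.add_sub_cancel, ret]
  ring

include hS in
lemma IsHedgingSystem.measurable_hedgeIncr {n : ℕ} (h1 : 1 ≤ n) (hn : n ≤ N) :
    Measurable fun p : ℝ × ℝ => hedgeIncr v w n p.1 p.2 := by
  have := hS.measurable_value n hn
  have := hS.measurable_value (n - 1) (by omega)
  have := hS.measurable_hedge n h1 hn
  unfold hedgeIncr
  fun_prop

include hM hs₀ hS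

lemma IsHedgingSystem.isAdmissible : IsAdmissible P F N (price s₀ X) (systemHedge s₀ X w) where
  predictable n h1 hn := ((hS.measurable_hedge n h1 hn).comp
    (hM.indepIncr.measurable_logPrice (n := n - 1) (by omega))).div
      (hM.indepIncr.measurable_price s₀ (by omega))
  square_integrable n h1 hn := by
    simp_rw [systemHedge_mul_incr hs₀]
    exact hM.memLp_mul_ret h1 hn ((hS.measurable_hedge n h1 hn).comp
      (hM.indepIncr.measurable_logPrice (n := n - 1) (by omega))) (hS.memLp_hedge n h1 hn)

lemma IsHedgingSystem.memLp_martingale {n : ℕ} (hn : n ≤ N) :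
    MemLp (systemMartingale s₀ X v w n) 2 P :=
  ((hS.memLp_value n hn).sub (memLp_const _)).sub ((hS.isAdmissible hM hs₀).memLp_gains hn)

lemma IsHedgingSystem.measurable_martingale {n : ℕ} (hn : n ≤ N) :
    Measurable[F n] (systemMartingale s₀ X v w n) :=
  (((hS.measurable_value n hn).comp (hM.indepIncr.measurable_logPrice hn)).sub_const _).sub
    (hM.measurable_gains (hS.isAdmissible hM hs₀).predictable hn)

lemma IsHedgingSystem.memLp_martingale_incr {n : ℕ} (hn : n ≤ N) :
    MemLp (systemMartingale s₀ X v w n - systemMartingale s₀ X v w (n - 1)) 2 P :=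
  (hS.memLp_martingale hM hs₀ hn).sub (hS.memLp_martingale hM hs₀ (by omega))

lemma IsHedgingSystem.condExp_martingale_incr {n : ℕ} (h1 : 1 ≤ n) (hn : n ≤ N) :
    P[systemMartingale s₀ X v w n - systemMartingale s₀ X v w (n - 1) | F (n - 1)] =ᵐ[P] 0 := by
  have hi := (hS.memLp_martingale_incr hM hs₀ hn).integrable (by norm_num)
  rw [show systemMartingale s₀ X v w n - systemMartingale s₀ X v w (n - 1) =
    fun ω => hedgeIncr v w n (logPrice s₀ X (n - 1) ω) (incr X n ω) from
    funext fun ω => systemMartingale_sub_pred hs₀ h1 ω] at hi ⊢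
  exact condExp_eq_zero_of_indep (F.le (n - 1))
    (hM.indepIncr.measurable_logPrice (n := n - 1) (by omega))
    ((hM.indepIncr.measurable_incr hn).mono (F.le _) le_rfl) (hM.indepIncr.indep n h1 hn)
    (ψ := fun p => hedgeIncr v w n p.1 p.2) (hS.measurable_hedgeIncr h1 hn) hi
    (hS.integral_eq_zero n h1 hn)

lemma IsHedgingSystem.condExp_martingale_incr_mul {n : ℕ} (h1 : 1 ≤ n) (hn : n ≤ N) :
    P[(systemMartingale s₀ X v w n - systemMartingale s₀ X v w (n - 1)) *
      (martingalePart (price s₀ X) F P n - martingalePart (price s₀ X) F P (n - 1)) |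
        F (n - 1)] =ᵐ[P] 0 := by
  have hS2 : ∀ k ≤ N, MemLp (price s₀ X k) 2 P := fun k hk => (hM.memLp_exp k hk).const_mul s₀
  have hdM2 : MemLp (martingalePart (price s₀ X) F P n -
      martingalePart (price s₀ X) F P (n - 1)) 2 P :=
    (memLp_martingalePart hS2 hn).sub (memLp_martingalePart hS2 (by omega))
  -- The factor `exp p.1` is the price `S_{n-1}` in `ΔM_n`; it comes out of the integral once the
  -- log price is frozen.
  let ψ : ℝ × ℝ → ℝ := fun p =>
    Real.exp p.1 * (hedgeIncr v w n p.1 p.2 * (Real.exp p.2 - 1 - retMean P X n))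
  have hψ : Measurable ψ := by
    have := hS.measurable_hedgeIncr h1 hn
    fun_prop
  have hae : (systemMartingale s₀ X v w n - systemMartingale s₀ X v w (n - 1)) *
      (martingalePart (price s₀ X) F P n - martingalePart (price s₀ X) F P (n - 1)) =ᵐ[P]
      fun ω => ψ (logPrice s₀ X (n - 1) ω, incr X n ω) := by
    filter_upwards [hM.incr_martingalePart h1 hn s₀] with ω hω
    rw [Pi.mul_apply, hω, Pi.sub_apply, systemMartingale_sub_pred hs₀ h1]
    simp only [ψ, exp_logPrice hs₀, ret]
    ring
  have hi := ((hS.memLp_martingale_incr hM hs₀ hn).integrable_mul hdM2).congr hae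
  refine (condExp_congr_ae hae).trans (condExp_eq_zero_of_indep (F.le (n - 1))
    (hM.indepIncr.measurable_logPrice (n := n - 1) (by omega))
    ((hM.indepIncr.measurable_incr hn).mono (F.le _) le_rfl) (hM.indepIncr.indep n h1 hn)
    hψ hi fun x => ?_)
  have := hS.integral_mul_eq_zero n h1 hn x
  simp only [ret] at this
  simp only [ψ]
  rw [integral_const_mul, this, mul_zero]

/-- A solution of the one-period equations yields a Föllmer-Schweizer decomposition. -/
theorem IsHedgingSystem.isRealFSDecomposition {H : Ω → ℝ}
    (hH : ∀ ω, H ω = v N (logPrice s₀ X N ω)) (hX0 : ∀ ω, X 0 ω = 0) :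
    IsRealFSDecomposition P F N (price s₀ X) H (v 0 (Real.log s₀)) (systemHedge s₀ X w)
      (systemMartingale s₀ X v w) where
  memLp_claim := by
    rw [funext hH]
    exact hS.memLp_value N le_rfl
  admissible := hS.isAdmissible hM hs₀
  martingale := .of_condExp_incr
    (fun n hn => (hS.measurable_martingale hM hs₀ hn).stronglyMeasurable)
    (fun n hn => (hS.memLp_martingale hM hs₀ hn).integrable (by norm_num))
    fun n h1 hn => hS.condExp_martingale_incr hM hs₀ h1 hn
  square_integrable n hn := hS.memLp_martingale hM hs₀ hn
  orthogonal := by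
    have hS2 : ∀ k ≤ N, MemLp (price s₀ X k) 2 P := fun k hk => (hM.memLp_exp k hk).const_mul s₀
    have hMm : ∀ n ≤ N, StronglyMeasurable[F n] (martingalePart (price s₀ X) F P n) :=
      fun n hn => stronglyMeasurable_martingalePart
        (hM.indepIncr.measurable_price s₀ hn).stronglyMeasurable
    have hM2 : ∀ n ≤ N, MemLp (martingalePart (price s₀ X) F P n) 2 P :=
      fun n hn => memLp_martingalePart hS2 hn
    have hLm := fun n hn => (hS.measurable_martingale hM hs₀ (n := n) hn).stronglyMeasurable
    have hL2 := fun n hn => hS.memLp_martingale hM hs₀ (n := n) hn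
    refine .of_condExp_incr (fun n hn => (hLm n hn).mul (hMm n hn))
      (fun n hn => (hL2 n hn).integrable_mul (hM2 n hn)) fun n h1 hn => ?_
    have hn' : n - 1 ≤ N := by omega
    have hdL2 := hS.memLp_martingale_incr hM hs₀ hn
    have hLM := hS.condExp_martingale_incr_mul hM hs₀ h1 hn
    have hLc := hS.condExp_martingale_incr hM hs₀ h1 hn
    set L := systemMartingale s₀ X v w
    set M := martingalePart (price s₀ X) F P
    have hdM : P[M n - M (n - 1) | F (n - 1)] =ᵐ[P] 0 := condExp_incr_martingalePart h1
      (((hS2 n hn).sub (hS2 _ hn')).integrable (by norm_num))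
    have hdM2 : MemLp (M n - M (n - 1)) 2 P := (hM2 n hn).sub (hM2 _ hn')
    have hi1 := hdL2.integrable_mul hdM2
    have hi2 := (hL2 _ hn').integrable_mul hdM2
    have hi3 := (hM2 _ hn').integrable_mul hdL2
    have heq : ((fun ω => L n ω * M n ω) - fun ω => L (n - 1) ω * M (n - 1) ω) =
        (L n - L (n - 1)) * (M n - M (n - 1)) +
          (L (n - 1) * (M n - M (n - 1)) + M (n - 1) * (L n - L (n - 1))) := by
      ext ω
      simp only [Pi.mul_apply, Pi.sub_apply, Pi.add_apply]
      ring
    rw [heq]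
    filter_upwards [condExp_add hi1 (hi2.add hi3) (F (n - 1)), condExp_add hi2 hi3 (F (n - 1)),
      condExp_mul_of_stronglyMeasurable_left (hLm _ hn') hi2 (hdM2.integrable (by norm_num)),
      condExp_mul_of_stronglyMeasurable_left (hMm _ hn') hi3 (hdL2.integrable (by norm_num)),
      hLM, hLc, hdM] with ω e1 e2 e3 e4 e5 e6 e7
    rw [e1, Pi.add_apply, e2, Pi.add_apply, e3, e4, e5]
    simp [e6, e7]
  expectation_zero := by
    -- `X_0 = 0` puts the initial log price at `log s₀`, so `L_0` vanishes identically.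
    have : ∀ ω, systemMartingale s₀ X v w 0 ω = 0 := fun ω => by
      simp [systemMartingale, logPrice, hX0, gains]
    simp [this]
  decomposition := .of_forall fun ω => by
    rw [hH, systemMartingale]
    ring

end Construction

/-! ### Exponential transforms on a vertical strip -/

section Transform

/-- A measurable, essentially bounded kernel. -/
structure IsBddKernel (ρ : Measure ℂ) (K : ℂ → ℂ) : Prop where
  measurable : Measurable K
  bdd : ∃ C : ℝ, ∀ᵐ z ∂ρ, ‖K z‖ ≤ C

variable {ρ : Measure ℂ} {K K' : ℂ → ℂ}

lemma IsBddKernel.const (c : ℂ) : IsBddKernel ρ fun _ => c :=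
  ⟨measurable_const, ‖c‖, .of_forall fun _ => le_rfl⟩

lemma IsBddKernel.mul (h : IsBddKernel ρ K) (h' : IsBddKernel ρ K') :
    IsBddKernel ρ fun z => K z * K' z := by
  obtain ⟨C, hC⟩ := h.bdd
  obtain ⟨C', hC'⟩ := h'.bdd
  refine ⟨h.measurable.mul h'.measurable, C * C', ?_⟩
  filter_upwards [hC, hC'] with z hz hz'
  rw [norm_mul]
  exact mul_le_mul hz hz' (norm_nonneg _) ((norm_nonneg _).trans hz)

lemma IsBddKernel.sub (h : IsBddKernel ρ K) (h' : IsBddKernel ρ K') :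
    IsBddKernel ρ fun z => K z - K' z := by
  obtain ⟨C, hC⟩ := h.bdd
  obtain ⟨C', hC'⟩ := h'.bdd
  refine ⟨h.measurable.sub h'.measurable, C + C', ?_⟩
  filter_upwards [hC, hC'] with z hz hz'
  exact (norm_sub_le _ _).trans (add_le_add hz hz')

lemma IsBddKernel.prod {ι : Type*} (s : Finset ι) {K : ι → ℂ → ℂ}
    (h : ∀ i ∈ s, IsBddKernel ρ (K i)) : IsBddKernel ρ fun z => ∏ i ∈ s, K i z := by
  classical
  induction s using Finset.induction_on with
  | empty => simpa using IsBddKernel.const 1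
  | insert i s hi ih =>
    simp only [Finset.prod_insert hi]
    exact (h i (Finset.mem_insert_self _ _)).mul
      (ih fun j hj => h j (Finset.mem_insert_of_mem hj))

/-- The envelope `exp(a x) + exp(b x)` of the functions `exp(z x)` with `a ≤ Re z ≤ b`. -/
noncomputable def expEnv (a b x : ℝ) : ℝ := Real.exp (a * x) + Real.exp (b * x)

lemma expEnv_nonneg (a b x : ℝ) : 0 ≤ expEnv a b x := by unfold expEnv; positivity

lemma norm_cexp_le_expEnv {a b : ℝ} {z : ℂ} (h : a ≤ z.re ∧ z.re ≤ b) (x : ℝ) :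
    ‖Complex.exp (z * x)‖ ≤ expEnv a b x := by
  rw [Complex.norm_exp, Complex.re_mul_ofReal, expEnv]
  rcases le_total 0 x with hx | hx
  · have := Real.exp_le_exp.2 (mul_le_mul_of_nonneg_right h.2 hx)
    linarith [Real.exp_pos (a * x)]
  · have := Real.exp_le_exp.2 (mul_le_mul_of_nonpos_right h.1 hx)
    linarith [Real.exp_pos (b * x)]

/-- Expanding the product leaves two positive cross terms. This separates a deterministic log price
from a random increment in every domination below. -/
lemma expEnv_add_le (a b x y : ℝ) : expEnv a b (x + y) ≤ expEnv a b x * expEnv a b y := by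
  simp only [expEnv, mul_add, Real.exp_add]
  nlinarith [mul_pos (Real.exp_pos (a * x)) (Real.exp_pos (b * y)),
    mul_pos (Real.exp_pos (b * x)) (Real.exp_pos (a * y))]

/-- `x ↦ ∫ K(z) exp(z x) θ(z) ρ(dz)`. -/
noncomputable def expTransform (ρ : Measure ℂ) (θ K : ℂ → ℂ) (x : ℝ) : ℂ :=
  ∫ z, K z * Complex.exp (z * x) * θ z ∂ρ

variable [IsFiniteMeasure ρ] {θ : ℂ → ℂ} (hθ : IsBddKernel ρ θ) {a b : ℝ}
  (hab : ∀ᵐ z ∂ρ, a ≤ z.re ∧ z.re ≤ b)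

omit [IsFiniteMeasure ρ] in
lemma measurable_expTransform [SFinite ρ] (hθ : Measurable θ) (hK : Measurable K) :
    Measurable (expTransform ρ θ K) := by
  have : Measurable fun p : ℝ × ℂ => K p.2 * Complex.exp (p.2 * p.1) * θ p.2 := by fun_prop
  exact this.stronglyMeasurable.integral_prod_right'.measurable

include hθ hab

omit [IsFiniteMeasure ρ] in
-- The null set is fixed before `x`, so the bound survives when `x` is random.
lemma IsBddKernel.exists_bound (hK : IsBddKernel ρ K) :
    ∃ C, 0 ≤ C ∧ ∀ᵐ z ∂ρ, ∀ x : ℝ, ‖K z * Complex.exp (z * x) * θ z‖ ≤ C * expEnv a b x := by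
  obtain ⟨C, hC⟩ := (hK.mul hθ).bdd
  refine ⟨|C|, abs_nonneg _, ?_⟩
  filter_upwards [hC, hab] with z hz hz' x
  rw [mul_right_comm, norm_mul]
  exact mul_le_mul (hz.trans (le_abs_self C)) (norm_cexp_le_expEnv hz' x) (norm_nonneg _)
    (abs_nonneg _)

lemma IsBddKernel.integrable_mul_cexp (hK : IsBddKernel ρ K) (x : ℝ) :
    Integrable (fun z => K z * Complex.exp (z * x) * θ z) ρ := by
  obtain ⟨C, -, hC⟩ := hθ.exists_bound hab hK
  have h1 := hK.measurable
  have h2 := hθ.measurable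
  refine Integrable.of_bound (C := C * expEnv a b x) (by fun_prop) ?_
  filter_upwards [hC] with z hz using hz x

lemma IsBddKernel.exists_norm_expTransform_le (hK : IsBddKernel ρ K) :
    ∃ C, 0 ≤ C ∧ ∀ x, ‖expTransform ρ θ K x‖ ≤ C * expEnv a b x := by
  obtain ⟨C, hC0, hC⟩ := hθ.exists_bound hab hK
  refine ⟨C * ρ.real Set.univ, by positivity, fun x => ?_⟩
  refine (norm_integral_le_of_norm_le_const (C := C * expEnv a b x) ?_).trans (le_of_eq ?_)
  · filter_upwards [hC] with z hz using hz x
  · ring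

lemma IsBddKernel.expTransform_sub (hK : IsBddKernel ρ K) (hK' : IsBddKernel ρ K') (x : ℝ) :
    expTransform ρ θ (fun z => K z - K' z) x = expTransform ρ θ K x - expTransform ρ θ K' x := by
  rw [expTransform, expTransform, expTransform,
    ← integral_sub (hθ.integrable_mul_cexp hab hK x) (hθ.integrable_mul_cexp hab hK' x)]
  simp only [sub_mul]

omit hθ hab [IsFiniteMeasure ρ] in
lemma expTransform_mul_const (c : ℂ) (x : ℝ) :
    expTransform ρ θ (fun z => K z * c) x = expTransform ρ θ K x * c := by
  rw [expTransform, expTransform, ← integral_mul_const]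
  congr 1
  ext z
  ring

/-- Fubini, dominated by a multiple of the envelope at `Z` times `|k|`: averaging over a shift
multiplies the kernel by an exponential moment. -/
lemma IsBddKernel.integral_expTransform {Ω : Type*} {mΩ : MeasurableSpace Ω} {P : Measure Ω}
    [IsProbabilityMeasure P] {Z k : Ω → ℝ} (hZ : Measurable Z) (hk : Measurable k)
    (hint : Integrable (fun ω => expEnv a b (Z ω) * k ω) P) (hK : IsBddKernel ρ K) (x : ℝ) :
    ∫ ω, expTransform ρ θ K (x + Z ω) * k ω ∂P =
      expTransform ρ θ (fun z => K z * ∫ ω, Complex.exp (z * Z ω) * k ω ∂P) x := by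
  obtain ⟨C, hC0, hC⟩ := hθ.exists_bound hab hK
  have h1 := hK.measurable
  have h2 := hθ.measurable
  let Φ : Ω → ℂ → ℂ := fun ω z => K z * Complex.exp (z * ((x + Z ω : ℝ) : ℂ)) * θ z * k ω
  have hΦm : Measurable (Function.uncurry Φ) := by
    unfold Φ Function.uncurry
    fun_prop
  have hdom : Integrable (fun p : Ω × ℂ =>
      (C * expEnv a b x) * ‖expEnv a b (Z p.1) * k p.1‖) (P.prod ρ) :=
    (hint.norm.comp_fst ρ).const_mul _
  have hΦ : Integrable (Function.uncurry Φ) (P.prod ρ) := by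
    refine hdom.mono' hΦm.aestronglyMeasurable ?_
    have hC' : ∀ᵐ p : Ω × ℂ ∂P.prod ρ,
        ∀ y : ℝ, ‖K p.2 * Complex.exp (p.2 * y) * θ p.2‖ ≤ C * expEnv a b y :=
      Measure.quasiMeasurePreserving_snd.ae hC
    filter_upwards [hC'] with p hp
    simp only [Function.uncurry, Φ]
    rw [norm_mul, Complex.norm_real, norm_mul (expEnv a b (Z p.1)),
      Real.norm_of_nonneg (expEnv_nonneg _ _ _), ← mul_assoc]
    refine mul_le_mul_of_nonneg_right ((hp _).trans ?_) (norm_nonneg _)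
    rw [mul_assoc]
    exact mul_le_mul_of_nonneg_left (expEnv_add_le _ _ _ _) hC0
  have hl : ∀ ω, expTransform ρ θ K (x + Z ω) * k ω = ∫ z, Φ ω z ∂ρ := fun ω => by
    rw [expTransform, ← integral_mul_const]
  have hr : ∀ z, K z * (∫ ω, Complex.exp (z * Z ω) * k ω ∂P) * Complex.exp (z * x) * θ z =
      ∫ ω, Φ ω z ∂P := fun z => by
    rw [show K z * (∫ ω, Complex.exp (z * Z ω) * k ω ∂P) * Complex.exp (z * x) * θ z =
      (K z * Complex.exp (z * x) * θ z) * ∫ ω, Complex.exp (z * Z ω) * k ω ∂P by ring,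
      ← integral_const_mul]
    congr 1
    ext ω
    simp only [Φ]
    push_cast
    rw [mul_add, Complex.exp_add]
    ring
  rw [expTransform]
  simp_rw [hl, hr]
  exact integral_integral_swap hΦ

end Transform

/-! ### Boundedness of `m`, `g` and `h` on the strip -/

section Kernels

variable {Ω : Type*} {mΩ : MeasurableSpace Ω} {P : Measure Ω} {F : Filtration ℕ mΩ} {N : ℕ}
  {X : ℕ → Ω → ℝ} [IsProbabilityMeasure P] {a b : ℝ}

/-- The exponential moments that dominate `exp(z X_N)` for `a ≤ Re z ≤ b` are finite. -/
structure HasStripMoments (P : Measure Ω) (N : ℕ) (X : ℕ → Ω → ℝ) (a b : ℝ) : Prop where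
  memLp_env : ∀ n ≤ N, MemLp (fun ω => expEnv a b (X n ω)) 2 P
  memLp_env_incr : ∀ n, 1 ≤ n → n ≤ N → MemLp (fun ω => expEnv a b (incr X n ω)) 2 P

lemma HasStripMoments.of_mem_expDomain (hX : HasIndepIncrementsUpTo P F N X)
    (ha : ((2 * a : ℝ) : ℂ) ∈ expDomain P N X) (hb : ((2 * b : ℝ) : ℂ) ∈ expDomain P N X) :
    HasStripMoments P N X a b := by
  obtain ⟨a1, a2⟩ := hX.integrable_exp (mem_expDomain_ofReal.1 ha)
  obtain ⟨b1, b2⟩ := hX.integrable_exp (mem_expDomain_ofReal.1 hb)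
  have hm : ∀ n ≤ N, Measurable (X n) := fun n hn => (hX.adapted n hn).mono (F.le _) le_rfl
  have hm' : ∀ n ≤ N, Measurable (incr X n) := fun n hn =>
    (hX.measurable_incr hn).mono (F.le _) le_rfl
  exact ⟨fun n hn => (memLp_two_exp (hm n hn) (a1 n hn)).add (memLp_two_exp (hm n hn) (b1 n hn)),
    fun n h1 hn => (memLp_two_exp (hm' n hn) (a2 n h1 hn)).add
      (memLp_two_exp (hm' n hn) (b2 n h1 hn))⟩

variable (hM : IsRegularMarket P F N X) (hB : HasStripMoments P N X a b) {ρ : Measure ℂ}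
  (hab : ∀ᵐ z ∂ρ, a ≤ z.re ∧ z.re ≤ b) {n : ℕ} (h1 : 1 ≤ n) (hn : n ≤ N)

include hM h1 hn in
lemma IsRegularMarket.memLp_exp_incr : MemLp (fun ω => Real.exp (incr X n ω)) 2 P :=
  ((hM.memLp_ret n h1 hn).add (memLp_const 1)).ae_eq (.of_forall fun ω => by simp [ret])

lemma m_add_one (z : ℂ) (n : ℕ) :
    m P X (z + 1) n = ∫ ω, Complex.exp (z * incr X n ω) * (Real.exp (incr X n ω) : ℝ) ∂P := by
  rw [m, complexMGF]
  congr 1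
  ext ω
  rw [add_mul, one_mul, Complex.exp_add, Complex.ofReal_exp]

/-- On the strip the integrand is dominated by the envelope, uniformly in `z`. -/
lemma isBddKernel_integral (hab : ∀ᵐ z ∂ρ, a ≤ z.re ∧ z.re ≤ b) {Z k : Ω → ℝ} (hZ : Measurable Z)
    (hk : Measurable k) (hint : Integrable (fun ω => expEnv a b (Z ω) * k ω) P) :
    IsBddKernel ρ fun z => ∫ ω, Complex.exp (z * Z ω) * k ω ∂P := by
  constructor
  · have : Measurable fun p : ℂ × Ω => Complex.exp (p.1 * Z p.2) * k p.2 := by fun_prop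
    exact this.stronglyMeasurable.integral_prod_right'.measurable
  · refine ⟨∫ ω, ‖expEnv a b (Z ω) * k ω‖ ∂P, ?_⟩
    filter_upwards [hab] with z hz
    refine norm_integral_le_of_norm_le hint.norm (.of_forall fun ω => ?_)
    rw [norm_mul, norm_mul, Complex.norm_real, Real.norm_of_nonneg (expEnv_nonneg _ _ _)]
    exact mul_le_mul_of_nonneg_right (norm_cexp_le_expEnv hz _) (norm_nonneg _)

include hM hB hab hn

include h1

lemma isBddKernel_m : IsBddKernel ρ fun z => m P X z n := by
  have := isBddKernel_integral (P := P) (k := fun _ => 1) hab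
    ((hM.indepIncr.measurable_incr hn).mono (F.le _) le_rfl) measurable_const
    (by simpa using (hB.memLp_env_incr n h1 hn).integrable (by norm_num))
  simpa [m, complexMGF] using this

lemma isBddKernel_m_add_one : IsBddKernel ρ fun z => m P X (z + 1) n := by
  have hm := (hM.indepIncr.measurable_incr hn).mono (F.le n) le_rfl
  simp_rw [m_add_one]
  exact isBddKernel_integral (P := P) hab hm (Real.measurable_exp.comp hm)
    ((hB.memLp_env_incr n h1 hn).integrable_mul (hM.memLp_exp_incr h1 hn))

lemma isBddKernel_g : IsBddKernel ρ fun z => g P X z n := by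
  have := ((isBddKernel_m_add_one hM hB hab h1 hn).sub
    ((IsBddKernel.const (m P X 1 n)).mul (isBddKernel_m hM hB hab h1 hn))).mul
      (IsBddKernel.const (m P X 2 n - m P X 1 n ^ 2)⁻¹)
  simpa only [g, div_eq_mul_inv] using this

omit h1 hn in
lemma isBddKernel_h (n : ℕ) : IsBddKernel ρ fun z => h P N X z n := by
  refine IsBddKernel.prod _ fun i hi => ?_
  have := Finset.mem_Icc.1 hi
  exact (isBddKernel_m hM hB hab (by omega) this.2).sub
    ((isBddKernel_g hM hB hab (by omega) this.2).mul (IsBddKernel.const _))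

end Kernels

/-! ### The one-period equations for the value functions -/

section System

variable {Ω : Type*} {mΩ : MeasurableSpace Ω} {P : Measure Ω} {F : Filtration ℕ mΩ} {N : ℕ}
  {X : ℕ → Ω → ℝ} {a b : ℝ}

/-- The value function `x ↦ ∫ h(z, n) exp(z x) θ(z) ρ(dz)`. -/
noncomputable def valueFun (P : Measure Ω) (N : ℕ) (X : ℕ → Ω → ℝ) (ρ : Measure ℂ) (θ : ℂ → ℂ)
    (n : ℕ) : ℝ → ℂ :=
  expTransform ρ θ fun z => h P N X z n

/-- The hedge amount `x ↦ ∫ g(z, n) h(z, n) exp(z x) θ(z) ρ(dz)`. -/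
noncomputable def hedgeFun (P : Measure Ω) (N : ℕ) (X : ℕ → Ω → ℝ) (ρ : Measure ℂ) (θ : ℂ → ℂ)
    (n : ℕ) : ℝ → ℂ :=
  expTransform ρ θ fun z => g P X z n * h P N X z n

lemma h_pred (z : ℂ) {n : ℕ} (h1 : 1 ≤ n) (hn : n ≤ N) :
    h P N X z (n - 1) = (m P X z n - g P X z n * (m P X 1 n - 1)) * h P N X z n := by
  rw [h, h, Nat.sub_add_cancel h1, ← Finset.insert_Icc_add_one_left_eq_Icc hn,
    Finset.prod_insert (by simp)]

lemma h_terminal (z : ℂ) : h P N X z N = 1 := by simp [h]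

variable [IsProbabilityMeasure P] {ρ : Measure ℂ} [IsFiniteMeasure ρ] {θ : ℂ → ℂ}
  (hM : IsRegularMarket P F N X) (hB : HasStripMoments P N X a b) (hθ : IsBddKernel ρ θ)
  (hab : ∀ᵐ z ∂ρ, a ≤ z.re ∧ z.re ≤ b) {n : ℕ}

include hM hB hθ hab

lemma integrable_valueFun_mul (h1 : 1 ≤ n) (hn : n ≤ N) {k : Ω → ℝ} (hk : MemLp k 2 P) (x : ℝ) :
    Integrable (fun ω => valueFun P N X ρ θ n (x + incr X n ω) * k ω) P := by
  obtain ⟨C, hC0, hC⟩ := hθ.exists_norm_expTransform_le hab (isBddKernel_h hM hB hab n)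
  have hm := (hM.indepIncr.measurable_incr hn).mono (F.le n) le_rfl
  have hV : Measurable (valueFun P N X ρ θ n) :=
    measurable_expTransform hθ.measurable (isBddKernel_h hM hB hab n).measurable
  have hi := ((hB.memLp_env_incr n h1 hn).integrable_mul hk).norm.const_mul (C * expEnv a b x)
  refine hi.mono' ((hV.comp (hm.const_add x)).aestronglyMeasurable.mul
    (Complex.measurable_ofReal.comp_aemeasurable hk.1.aemeasurable).aestronglyMeasurable)
    (.of_forall fun ω => ?_)
  rw [norm_mul, Complex.norm_real, Pi.mul_apply, norm_mul (expEnv a b (incr X n ω)),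
    Real.norm_of_nonneg (expEnv_nonneg _ _ _), ← mul_assoc]
  refine mul_le_mul_of_nonneg_right ((hC _).trans ?_) (norm_nonneg _)
  rw [mul_assoc]
  exact mul_le_mul_of_nonneg_left (expEnv_add_le _ _ _ _) hC0

lemma integral_valueFun (h1 : 1 ≤ n) (hn : n ≤ N) (x : ℝ) :
    ∫ ω, valueFun P N X ρ θ n (x + incr X n ω) ∂P =
      expTransform ρ θ (fun z => h P N X z n * m P X z n) x := by
  have := hθ.integral_expTransform (P := P) (k := fun _ => 1) hab
    ((hM.indepIncr.measurable_incr hn).mono (F.le n) le_rfl) measurable_const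
    (by simpa using (hB.memLp_env_incr n h1 hn).integrable (by norm_num))
    (isBddKernel_h hM hB hab n) x
  simpa [m, complexMGF, valueFun] using this

lemma integral_valueFun_mul_exp (h1 : 1 ≤ n) (hn : n ≤ N) (x : ℝ) :
    ∫ ω, valueFun P N X ρ θ n (x + incr X n ω) * (Real.exp (incr X n ω) : ℝ) ∂P =
      expTransform ρ θ (fun z => h P N X z n * m P X (z + 1) n) x := by
  have hm := (hM.indepIncr.measurable_incr hn).mono (F.le n) le_rfl
  simp_rw [m_add_one]
  exact hθ.integral_expTransform (P := P) hab hm (Real.measurable_exp.comp hm)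
    ((hB.memLp_env_incr n h1 hn).integrable_mul (hM.memLp_exp_incr h1 hn))
    (isBddKernel_h hM hB hab n) x

/-- At the level of kernels this is the recursion `h_pred`, with `m(1, n) - 1 = E[r_n]`. -/
lemma valueFun_pred (h1 : 1 ≤ n) (hn : n ≤ N) (x : ℝ) :
    valueFun P N X ρ θ (n - 1) x = ∫ ω, valueFun P N X ρ θ n (x + incr X n ω) ∂P -
      hedgeFun P N X ρ θ n x * retMean P X n := by
  have kh := isBddKernel_h hM hB hab n
  have km := isBddKernel_m hM hB hab h1 hn
  have kg := isBddKernel_g hM hB hab h1 hn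
  rw [integral_valueFun hM hB hθ hab h1 hn, hedgeFun, ← expTransform_mul_const,
    ← hθ.expTransform_sub hab (kh.mul km) ((kg.mul kh).mul (IsBddKernel.const _)), valueFun]
  congr 1
  ext z
  rw [h_pred z h1 hn, hM.m_one h1 hn]
  push_cast
  ring

/-- The normal equation of the regression: for each `z` it is the definition of `g` with the
denominator `Var(r_n)` cleared. -/
lemma integral_valueFun_mul_ret (h1 : 1 ≤ n) (hn : n ≤ N) (x : ℝ) :
    ∫ ω, valueFun P N X ρ θ n (x + incr X n ω) * ((ret X n ω - retMean P X n : ℝ) : ℂ) ∂P =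
      hedgeFun P N X ρ θ n x * ((retSq P X n - retMean P X n ^ 2 : ℝ) : ℂ) := by
  have kh := isBddKernel_h hM hB hab n
  have km := isBddKernel_m hM hB hab h1 hn
  have km1 := isBddKernel_m_add_one hM hB hab h1 hn
  have hi1 := integrable_valueFun_mul hM hB hθ hab h1 hn (hM.memLp_exp_incr h1 hn) x
  have hi2 : Integrable (fun ω => valueFun P N X ρ θ n (x + incr X n ω) *
      ((retMean P X n + 1 : ℝ) : ℂ)) P :=
    integrable_valueFun_mul hM hB hθ hab h1 hn (memLp_const (retMean P X n + 1)) x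
  have hsplit : ∀ ω, valueFun P N X ρ θ n (x + incr X n ω) *
      ((ret X n ω - retMean P X n : ℝ) : ℂ) =
      valueFun P N X ρ θ n (x + incr X n ω) * (Real.exp (incr X n ω) : ℝ) -
        valueFun P N X ρ θ n (x + incr X n ω) * ((retMean P X n + 1 : ℝ) : ℂ) := fun ω => by
    rw [ret]
    push_cast
    ring
  have hvar : ((retSq P X n - retMean P X n ^ 2 : ℝ) : ℂ) ≠ 0 :=
    Complex.ofReal_ne_zero.2 (hM.retVar_pos h1 hn).ne'
  simp_rw [hsplit]
  rw [integral_sub hi1 hi2, integral_mul_const, integral_valueFun_mul_exp hM hB hθ hab h1 hn,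
    integral_valueFun hM hB hθ hab h1 hn, ← expTransform_mul_const,
    ← hθ.expTransform_sub hab (kh.mul km1) ((kh.mul km).mul (IsBddKernel.const _)), hedgeFun,
    ← expTransform_mul_const]
  congr 1
  ext z
  have hden : m P X 2 n - m P X 1 n ^ 2 = ((retSq P X n - retMean P X n ^ 2 : ℝ) : ℂ) := by
    rw [hM.m_one h1 hn, hM.m_two h1 hn]
    push_cast
    ring
  rw [g, hden, mul_right_comm (_ / _), div_mul_cancel₀ _ hvar, hM.m_one h1 hn]
  ring

/-- In the normal equation the left side is real and the variance is a nonzero real. -/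
lemma hedgeFun_im (h1 : 1 ≤ n) (hn : n ≤ N) (hV : ∀ x, (valueFun P N X ρ θ n x).im = 0) (x : ℝ) :
    (hedgeFun P N X ρ θ n x).im = 0 := by
  have hVr : ∀ y, valueFun P N X ρ θ n y = ((valueFun P N X ρ θ n y).re : ℂ) := fun y =>
    Complex.ext rfl (by simp [hV y])
  have h := integral_valueFun_mul_ret hM hB hθ hab h1 hn x
  have hreal : ∫ ω, valueFun P N X ρ θ n (x + incr X n ω) *
      ((ret X n ω - retMean P X n : ℝ) : ℂ) ∂P =
      ((∫ ω, (valueFun P N X ρ θ n (x + incr X n ω)).re * (ret X n ω - retMean P X n) ∂P : ℝ) :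
        ℂ) := by
    rw [← integral_complex_ofReal]
    refine integral_congr_ae (.of_forall fun ω => ?_)
    simp only
    rw [Complex.ofReal_mul, ← hVr]
  rw [hreal] at h
  have := congrArg Complex.im h
  rw [Complex.ofReal_im, Complex.im_mul_ofReal] at this
  exact (mul_eq_zero.1 this.symm).resolve_right (hM.retVar_pos h1 hn).ne'

/-- Realness propagates backwards in time through the recursion, so no conjugation symmetry of the
complex measure is needed. -/
lemma valueFun_im (hf : ∀ x, (valueFun P N X ρ θ N x).im = 0) (hn : n ≤ N) (x : ℝ) :
    (valueFun P N X ρ θ n x).im = 0 := by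
  have key : ∀ k ≤ N, ∀ x, (valueFun P N X ρ θ (N - k) x).im = 0 := by
    intro k
    induction k with
    | zero => exact fun _ => hf
    | succ k ih =>
      intro hk x
      have ih' := ih (by omega)
      have hVr : ∀ y, valueFun P N X ρ θ (N - k) y = ((valueFun P N X ρ θ (N - k) y).re : ℂ) :=
        fun y => Complex.ext rfl (by simp [ih' y])
      have hW := hedgeFun_im hM hB hθ hab (n := N - k) (by omega) (by omega) ih' x
      rw [← Nat.sub_sub, valueFun_pred hM hB hθ hab (by omega) (by omega),
        integral_congr_ae (.of_forall fun ω => hVr (x + incr X (N - k) ω)),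
        integral_complex_ofReal, Complex.sub_im, Complex.ofReal_im, Complex.im_mul_ofReal, hW]
      simp
  have := key (N - n) (Nat.sub_le _ _) x
  rwa [Nat.sub_sub_self hn] at this

lemma memLp_expTransform_logPrice {K : ℂ → ℂ} (hK : IsBddKernel ρ K) (s₀ : ℝ) (hn : n ≤ N) :
    MemLp (fun ω => (expTransform ρ θ K (logPrice s₀ X n ω)).re) 2 P := by
  obtain ⟨C, hC0, hC⟩ := hθ.exists_norm_expTransform_le hab hK
  have hm := (hM.indepIncr.measurable_logPrice (s₀ := s₀) hn).mono (F.le n) le_rfl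
  have hT : Measurable (expTransform ρ θ K) := measurable_expTransform hθ.measurable hK.measurable
  refine MemLp.of_le ((hB.memLp_env n hn).const_mul (C * expEnv a b (Real.log s₀)))
    (Complex.measurable_re.comp (hT.comp hm)).aestronglyMeasurable (.of_forall fun ω => ?_)
  refine (Complex.abs_re_le_norm _).trans ((hC _).trans ?_)
  rw [Real.norm_of_nonneg (by
    have := expEnv_nonneg a b (Real.log s₀)
    have := expEnv_nonneg a b (X n ω)
    positivity), mul_assoc]
  exact mul_le_mul_of_nonneg_left (expEnv_add_le _ _ _ _) hC0

lemma isHedgingSystem (s₀ : ℝ) (hf : ∀ x, (valueFun P N X ρ θ N x).im = 0) :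
    IsHedgingSystem P N s₀ X (fun n x => (valueFun P N X ρ θ n x).re)
      fun n x => (hedgeFun P N X ρ θ n x).re := by
  have kgh : ∀ n, 1 ≤ n → n ≤ N → IsBddKernel ρ fun z => g P X z n * h P N X z n :=
    fun n h1 hn => (isBddKernel_g hM hB hab h1 hn).mul (isBddKernel_h hM hB hab n)
  have hVr : ∀ n ≤ N, ∀ y, valueFun P N X ρ θ n y = ((valueFun P N X ρ θ n y).re : ℂ) :=
    fun n hn y => Complex.ext rfl (by simp [valueFun_im hM hB hθ hab hf hn y])
  have hWr : ∀ n, 1 ≤ n → n ≤ N → ∀ y,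
      hedgeFun P N X ρ θ n y = ((hedgeFun P N X ρ θ n y).re : ℂ) :=
    fun n h1 hn y => Complex.ext rfl
      (by simp [hedgeFun_im hM hB hθ hab h1 hn (valueFun_im hM hB hθ hab hf hn) y])
  have hVk : ∀ n, 1 ≤ n → n ≤ N → ∀ (k : Ω → ℝ), MemLp k 2 P → ∀ x,
      Integrable (fun ω => (valueFun P N X ρ θ n (x + incr X n ω)).re * k ω) P :=
    fun n h1 hn k hk x => by
      simpa only [RCLike.re_eq_complex_re, Complex.re_mul_ofReal] using
        (integrable_valueFun_mul hM hB hθ hab h1 hn hk x).re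
  have eB : ∀ n, 1 ≤ n → n ≤ N → ∀ x, (valueFun P N X ρ θ (n - 1) x).re =
      ∫ ω, (valueFun P N X ρ θ n (x + incr X n ω)).re ∂P -
        (hedgeFun P N X ρ θ n x).re * retMean P X n := fun n h1 hn x => by
    have := valueFun_pred hM hB hθ hab h1 hn x
    rw [integral_congr_ae (.of_forall fun ω => hVr n hn (x + incr X n ω)),
      integral_complex_ofReal] at this
    rw [this, Complex.sub_re, Complex.ofReal_re, Complex.re_mul_ofReal]
  have eA : ∀ n, 1 ≤ n → n ≤ N → ∀ x,
      ∫ ω, (valueFun P N X ρ θ n (x + incr X n ω)).re * (ret X n ω - retMean P X n) ∂P =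
        (hedgeFun P N X ρ θ n x).re * (retSq P X n - retMean P X n ^ 2) := fun n h1 hn x => by
    have := integral_valueFun_mul_ret hM hB hθ hab h1 hn x
    rw [integral_congr_ae (g := fun ω => (((valueFun P N X ρ θ n (x + incr X n ω)).re *
        (ret X n ω - retMean P X n) : ℝ) : ℂ)) (.of_forall fun ω => by
          simp only
          rw [Complex.ofReal_mul, ← hVr n hn]), integral_complex_ofReal, hWr n h1 hn,
        ← Complex.ofReal_mul] at this
    exact Complex.ofReal_injective this
  refine ⟨fun n hn => ?_, fun n h1 hn => ?_, fun n hn => ?_, fun n h1 hn => ?_,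
    fun n h1 hn x => ?_, fun n h1 hn x => ?_⟩
  · exact Complex.measurable_re.comp
      (measurable_expTransform hθ.measurable (isBddKernel_h hM hB hab n).measurable)
  · exact Complex.measurable_re.comp
      (measurable_expTransform hθ.measurable (kgh n h1 hn).measurable)
  · exact memLp_expTransform_logPrice hM hB hθ hab (isBddKernel_h hM hB hab n) s₀ hn
  · exact memLp_expTransform_logPrice hM hB hθ hab (kgh n h1 hn) s₀ (by omega)
  · have i1 : Integrable (fun ω => (valueFun P N X ρ θ n (x + incr X n ω)).re) P := by
      simpa using hVk n h1 hn (fun _ => 1) (memLp_const 1) x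
    have i2 : Integrable (fun ω => (hedgeFun P N X ρ θ n x).re * ret X n ω) P :=
      (hM.integrable_ret h1 hn).const_mul _
    have i3 : Integrable (fun ω => (valueFun P N X ρ θ n (x + incr X n ω)).re -
        (valueFun P N X ρ θ (n - 1) x).re) P := i1.sub (integrable_const _)
    simp only [hedgeIncr]
    change ∫ ω, ((valueFun P N X ρ θ n (x + incr X n ω)).re -
      (valueFun P N X ρ θ (n - 1) x).re - (hedgeFun P N X ρ θ n x).re * ret X n ω) ∂P = 0
    rw [integral_sub i3 i2, integral_sub i1 (integrable_const _), integral_const_mul,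
      eB n h1 hn x]
    simp [retMean]
  -- The constant term dies against the centred return, and `E[r_n (r_n - E[r_n])] = Var(r_n)`
  -- matches the normal equation `eA`.
  · have hk : MemLp (fun ω => ret X n ω - retMean P X n) 2 P :=
      (hM.memLp_ret n h1 hn).sub (memLp_const _)
    have i1 := hVk n h1 hn _ hk x
    have i2 : Integrable (fun ω => (valueFun P N X ρ θ (n - 1) x).re *
        (ret X n ω - retMean P X n)) P := (hk.integrable (by norm_num)).const_mul _
    have i3 : Integrable (fun ω => (hedgeFun P N X ρ θ n x).re *
        (ret X n ω * (ret X n ω - retMean P X n))) P :=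
      ((hM.memLp_ret n h1 hn).integrable_mul hk).const_mul _
    have i12 : Integrable (fun ω => (valueFun P N X ρ θ n (x + incr X n ω)).re *
        (ret X n ω - retMean P X n) - (valueFun P N X ρ θ (n - 1) x).re *
        (ret X n ω - retMean P X n)) P := i1.sub i2
    have hsplit : ∀ ω, hedgeIncr (fun n x => (valueFun P N X ρ θ n x).re)
        (fun n x => (hedgeFun P N X ρ θ n x).re) n x (incr X n ω) *
        (ret X n ω - retMean P X n) =
        (valueFun P N X ρ θ n (x + incr X n ω)).re * (ret X n ω - retMean P X n) -
        (valueFun P N X ρ θ (n - 1) x).re * (ret X n ω - retMean P X n) -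
        (hedgeFun P N X ρ θ n x).re * (ret X n ω * (ret X n ω - retMean P X n)) := fun ω => by
      simp only [hedgeIncr, ret]
      ring
    have z1 : ∫ ω, (ret X n ω - retMean P X n) ∂P = 0 := by
      rw [integral_sub (hM.integrable_ret h1 hn) (integrable_const _)]
      simp [retMean]
    have z2 : ∫ ω, ret X n ω * (ret X n ω - retMean P X n) ∂P =
        retSq P X n - retMean P X n ^ 2 := by
      have i4 : Integrable (fun ω => ret X n ω * (ret X n ω - retMean P X n)) P :=
        (hM.memLp_ret n h1 hn).integrable_mul hk
      have : ∀ ω, ret X n ω * (ret X n ω - retMean P X n) - (ret X n ω - retMean P X n) ^ 2 =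
          retMean P X n * (ret X n ω - retMean P X n) := fun ω => by ring
      rw [← hM.integral_ret_sub_sq h1 hn, ← sub_eq_zero, ← integral_sub i4 hk.integrable_sq]
      rw [integral_congr_ae (.of_forall this), integral_const_mul, z1, mul_zero]
    simp_rw [hsplit]
    rw [integral_sub i12 i3, integral_sub i1 i2, integral_const_mul, integral_const_mul, z1, z2,
      eA n h1 hn x]
    ring

end System

/-! ### The strip of the measure and the main theorem -/

section Main

variable {Ω : Type*} {mΩ : MeasurableSpace Ω} {P : Measure Ω} {F : Filtration ℕ mΩ} {N : ℕ}
  {X : ℕ → Ω → ℝ}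

/-- Compactness makes the infimum and supremum of the real parts members of the set, so the moment
hypothesis applies at both endpoints. -/
lemma exists_strip (μ : ComplexMeasure ℂ) (hcpt : IsCompact (reSupport μ)) [IsProbabilityMeasure P]
    (hdom : ∀ x ∈ reSupport μ, ((2 * x : ℝ) : ℂ) ∈ expDomain P N X) :
    ∃ a b : ℝ, ((2 * a : ℝ) : ℂ) ∈ expDomain P N X ∧ ((2 * b : ℝ) : ℂ) ∈ expDomain P N X ∧
      ∀ᵐ z ∂μ.variation, a ≤ z.re ∧ z.re ≤ b := by
  have hae : ∀ᵐ z ∂μ.variation, z.re ∈ reSupport μ := by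
    filter_upwards [Measure.support_mem_ae (μ := μ.variation)] with z hz
    exact ⟨z, hz, rfl⟩
  rcases (reSupport μ).eq_empty_or_nonempty with he | hne
  -- With empty support the strip condition is vacuous, and `0` always has finite moments.
  · have h0 : ((2 * 0 : ℝ) : ℂ) ∈ expDomain P N X := mem_expDomain_ofReal.2 (by simp)
    refine ⟨0, 0, h0, h0, ?_⟩
    filter_upwards [hae] with z hz
    simp [he] at hz
  · refine ⟨sInf (reSupport μ), sSup (reSupport μ), hdom _ (hcpt.sInf_mem hne),
      hdom _ (hcpt.sSup_mem hne), ?_⟩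
    filter_upwards [hae] with z hz
    exact ⟨csInf_le hcpt.bddBelow hz, le_csSup hcpt.bddAbove hz⟩

lemma ofReal_exp_cpow (x : ℝ) (z : ℂ) : ((Real.exp x : ℝ) : ℂ) ^ z = Complex.exp (z * x) := by
  rw [Complex.cpow_def_of_ne_zero (by exact_mod_cast (Real.exp_pos x).ne'),
    ← Complex.ofReal_log (Real.exp_pos x).le, Real.log_exp, mul_comm]

/-- An integral against a complex measure of a bounded kernel times a power is an exponential
transform. -/
lemma exists_cintegral_eq_expTransform (μ : ComplexMeasure ℂ) {a b : ℝ}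
    (hab : ∀ᵐ z ∂μ.variation, a ≤ z.re ∧ z.re ≤ b) :
    ∃ θ : ℂ → ℂ, IsBddKernel μ.variation θ ∧ ∀ K, IsBddKernel μ.variation K → ∀ x : ℝ,
      cintegral μ (fun z => K z * ((Real.exp x : ℝ) : ℂ) ^ z) = expTransform μ.variation θ K x := by
  have := isFiniteMeasure_variation μ
  obtain ⟨θ, hm, hb, hμ⟩ := exists_density_complexMeasure μ
  refine ⟨θ, ⟨hm, 2, hb⟩, fun K hK x => ?_⟩
  simp_rw [ofReal_exp_cpow]
  refine integral_eq_integral_density μ hm hb hμ ?_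
  simpa using (IsBddKernel.const 1).integrable_mul_cexp hab hK x

end Main

end DiscreteHedging

theorem mainTheorem1 {Ω : Type*} {mΩ : MeasurableSpace Ω} (P : Measure Ω) [IsProbabilityMeasure P]
    (N : ℕ) (hN : 1 ≤ N) (F : Filtration ℕ mΩ) (X : ℕ → Ω → ℝ)
    (hX : DiscreteHedging.HasIndepIncrementsUpTo P F N X)
    (s₀ : ℝ) (hs₀ : 0 < s₀)
    -- the increments are not deterministic, and `2 ∈ D`
    (hnd : ∀ n, 1 ≤ n → n ≤ N → ¬ ∃ c : ℝ, ∀ᵐ ω ∂P, DiscreteHedging.incr X n ω = c)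
    (h2 : (2 : ℂ) ∈ DiscreteHedging.expDomain P N X)
    -- the complex measure, with `I₀` compact and `2 I₀ ⊆ D`
    (μ : ComplexMeasure ℂ)
    (hcpt : IsCompact (DiscreteHedging.reSupport μ))
    (hdom : ∀ x ∈ DiscreteHedging.reSupport μ,
      ((2 * x : ℝ) : ℂ) ∈ DiscreteHedging.expDomain P N X)
    -- the payoff function, real valued on prices
    (f : ℝ → ℝ)
    (hf : ∀ s : ℝ, 0 < s → (f s : ℂ) = DiscreteHedging.cintegral μ fun z => (s : ℂ) ^ z)
    (S : ℕ → Ω → ℝ) (hS : S = DiscreteHedging.price s₀ X)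
    (H : Ω → ℝ) (hH : ∀ ω, H ω = f (S N ω)) :
    -- `H` has a real discrete decomposition, with `H_n` and `ξ_n` given explicitly
    (∃ (H₀ : ℝ) (ξ L : ℕ → Ω → ℝ), DiscreteHedging.IsRealFSDecomposition P F N S H H₀ ξ L ∧
      (H₀ : ℂ) = DiscreteHedging.cintegral μ (fun z => DiscreteHedging.h P N X z 0 * (s₀ : ℂ) ^ z) ∧
      (∀ n ≤ N, ∀ᵐ ω ∂P, (DiscreteHedging.fsValue S H₀ ξ L n ω : ℂ) =
        DiscreteHedging.claimProcess P N s₀ X μ n ω) ∧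
      (∀ n, 1 ≤ n → n ≤ N → ∀ᵐ ω ∂P, (ξ n ω : ℂ) =
        DiscreteHedging.xiProcess P N s₀ X μ n ω)) ∧
    -- and every such decomposition yields the unique solution of the hedging problem
    (∀ (H₀ : ℝ) (ξ L : ℕ → Ω → ℝ), DiscreteHedging.IsRealFSDecomposition P F N S H H₀ ξ L →
      ∃ φ : ℕ → Ω → ℝ,
        (∀ n, 1 ≤ n → n ≤ N → ∀ ω, φ n ω = ξ n ω + DiscreteHedging.lam P s₀ X n ω *
          (DiscreteHedging.fsValue S H₀ ξ L (n - 1) ω - H₀ -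
            DiscreteHedging.gains S φ (n - 1) ω)) ∧
        DiscreteHedging.IsOptimal P F N S H H₀ φ ∧
        (∀ (V : ℝ) (ψ : ℕ → Ω → ℝ), DiscreteHedging.IsOptimal P F N S H V ψ →
          V = H₀ ∧ ∀ n, 1 ≤ n → n ≤ N → ∀ᵐ ω ∂P, ψ n ω = φ n ω)) := by
  open DiscreteHedging in
  subst hS
  have hM := IsRegularMarket.of_mem_expDomain hX h2 hnd
  refine ⟨?_, fun H₀ ξ L hD => ⟨optStrategy P s₀ X H₀ ξ L, fun n _ _ ω => ?_,
    hD.isOptimal_optStrategy hM hs₀⟩⟩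
  · obtain ⟨a, b, ha, hb, hab⟩ := exists_strip (P := P) (N := N) (X := X) μ hcpt hdom
    have hB := HasStripMoments.of_mem_expDomain hX ha hb
    have := isFiniteMeasure_variation μ
    obtain ⟨θ, hθ, hμ⟩ := exists_cintegral_eq_expTransform μ hab
    -- Since `h(z, N) = 1`, the terminal value function is the payoff, whose realness starts the
    -- backward induction.
    have hterm : ∀ x, (f (Real.exp x) : ℂ) = valueFun P N X μ.variation θ N x := fun x => by
      rw [hf _ (Real.exp_pos x), valueFun]
      simp_rw [h_terminal]
      rw [← hμ _ (IsBddKernel.const 1)]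
      simp only [one_mul]
    have him : ∀ x, (valueFun P N X μ.variation θ N x).im = 0 := fun x => by
      rw [← hterm, Complex.ofReal_im]
    have hsys := isHedgingSystem hM hB hθ hab s₀ him
    have hVr : ∀ n ≤ N, ∀ y, ((valueFun P N X μ.variation θ n y).re : ℂ) =
        valueFun P N X μ.variation θ n y :=
      fun n hn y => Complex.ext rfl (by simp [valueFun_im hM hB hθ hab him hn y])
    have hD := hsys.isRealFSDecomposition hM hs₀ (H := H) (fun ω => by
      rw [hH, ← exp_logPrice hs₀, ← hterm, Complex.ofReal_re]) hX.zero
    refine ⟨_, _, _, hD, ?_, fun n hn => .of_forall fun ω => ?_,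
      fun n h1 hn => .of_forall fun ω => ?_⟩
    · rw [hVr 0 (Nat.zero_le N), valueFun, ← hμ _ (isBddKernel_h hM hB hab 0), Real.exp_log hs₀]
    · rw [fsValue_system (v := fun n x => (valueFun P N X μ.variation θ n x).re), hVr n hn, valueFun, ← hμ _ (isBddKernel_h hM hB hab n),
        exp_logPrice hs₀, claimProcess]
    · have kg := (isBddKernel_g hM hB hab h1 hn).mul (isBddKernel_h hM hB hab n)
      have hWr : ((hedgeFun P N X μ.variation θ n (logPrice s₀ X (n - 1) ω)).re : ℂ) =
          hedgeFun P N X μ.variation θ n (logPrice s₀ X (n - 1) ω) :=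
        Complex.ext rfl (by
          simp [hedgeFun_im hM hB hθ hab h1 hn (valueFun_im hM hB hθ hab him hn)])
      have hp : ((price s₀ X (n - 1) ω : ℝ) : ℂ) ≠ 0 :=
        Complex.ofReal_ne_zero.2 (price_pos hs₀ _ _).ne'
      -- Dividing the hedge amount by `S_{n-1}` is absorbed into the kernel as a constant and lowers
      -- the exponent from `z` to `z - 1`.
      rw [systemHedge, Complex.ofReal_div, hWr, hedgeFun, div_eq_mul_inv, ← expTransform_mul_const,
        ← hμ _ (kg.mul (IsBddKernel.const _)), exp_logPrice hs₀, xiProcess]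
      congr 1
      ext z
      rw [Complex.cpow_sub _ _ hp, Complex.cpow_one]
      field_simp
  · rw [gains_optStrategy, optStrategy]
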